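/- For every $n\ge 1$ let $X_1=X_1^{(n)},\dots,X_n=X_n^{(n)}$ be independent real random variables on some probability space, with distribution functions $F_{n,1},\dots,F_{n,n}$ and average distribution function $\bar F_n=n^{-1}\sum_{i=1}^n F_{n,i}$, which is assumed to be continuous. The quantile function of a distribution function $F$ is its left-continuous inverse $u\mapsto\inf\{x: u\le F(x)\}$; $\bar Q_n$ denotes the quantile function of $\bar F_n$, $\widehat F(x)=n^{-1}\sum_{i=1}^n \mathbf 1\{X_i\le x\}$ the empirical distribution function, and $\widehat Q$ the empirical quantile function. Suppose that (Assumption 1) for every $n\ge 2$ the set $\{1,\dots,n\}$ is partitioned into groups $\mathcal I_{n,1},\dots,\mathcal I_{n,g}$ ($g$ may depend on $n$) of sizes $m_1,\dots,m_g$, all $m_j\ge 2$, such that $F_{n,i}=F_{n,i'}$ whenever $i,i'$ lie in the same group. Let $\tau\in(0,1)$, put $$V_n(\tau)=\frac1n\sum_{i=1}^n F_{n,i}(\bar Q_n(\tau))\{1-F_{n,i}(\bar Q_n(\tau))\},\qquad \widehat V(\tau)=\frac1n\sum_{j=1}^g\frac1{m_j-1}\sum_{\ell_1,\ell_2\in\mathcal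 I_{n,j}}\mathbf 1\{X_{\ell_1}\le\widehat Q(\tau),\ X_{\ell_2}>\widehat Q(\tau)\},$$ and suppose that (Assumption 2) $nV_n(\tau)\to\infty$ as $n\to\infty$. Then $$\left(\frac{n}{\widehat V(\tau)}\right)^{1/2}\bigl(\widehat F(\bar Q_n(\tau))-\tau\bigr)\xrightarrow{d}\mathcal N(0,1)\qquad(n\to\infty).$$ Moreover, for every $\alpha\in(0,1)$, with $\widehat c(\alpha)=\sqrt{\widehat V(\tau)/n}\;\Phi^{-1}(1-\alpha/2)$, where $\Phi^{-1}$ is the standard normal quantile function, $$P\bigl(\widehat Q(\tau-\widehat c(\alpha))<\bar Q_n(\tau)<\widehat Q(\tau+\widehat c(\alpha))\bigr)\to 1-\alpha .$$ (The statistic is given the value $0$ when $\widehat V(\tau)=0$; the probability of this event tends to $0$.) -/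

import Mathlib

open MeasureTheory ProbabilityTheory Filter Topology

noncomputable section

namespace HetQuantile

/-- The quantile function (left-continuous inverse) of a distribution function `F` on the line,
`u ↦ inf {x | u ≤ F x}`. -/
def quantile (F : ℝ → ℝ) (u : ℝ) : ℝ := sInf {x : ℝ | u ≤ F x}

section Population

variable {Ω : Type*} [MeasurableSpace Ω]

/-- The distribution function `x ↦ P (Y ≤ x)` of a real random variable `Y`. -/
def distFun (P : Measure Ω) (Y : Ω → ℝ) : ℝ → ℝ := fun x => cdf (P.map Y) x

/-- The average distribution function `n⁻¹ (F₁ + ⋯ + Fₙ)` of `n` random variables. -/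
def avgDistFun (P : Measure Ω) {n : ℕ} (X : Fin n → Ω → ℝ) : ℝ → ℝ :=
  fun x => (n : ℝ)⁻¹ * ∑ i, distFun P (X i) x

/-- The quantile function of the average distribution. -/
def avgQuantile (P : Measure Ω) {n : ℕ} (X : Fin n → Ω → ℝ) : ℝ → ℝ :=
  quantile (avgDistFun P X)

/-- The variance `V(τ) = n⁻¹ ∑ᵢ Fᵢ(q) (1 - Fᵢ(q))` at the quantile `q` of level `τ` of the
average distribution. -/
def avgVar (P : Measure Ω) {n : ℕ} (X : Fin n → Ω → ℝ) (τ : ℝ) : ℝ :=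
  (n : ℝ)⁻¹ * ∑ i, distFun P (X i) (avgQuantile P X τ) *
    (1 - distFun P (X i) (avgQuantile P X τ))

end Population

section Sample

/-- The empirical distribution function of the data `x₁, …, xₙ`. -/
def empDistFun {n : ℕ} (x : Fin n → ℝ) : ℝ → ℝ :=
  fun t => (n : ℝ)⁻¹ * ∑ i, if x i ≤ t then (1 : ℝ) else 0

/-- The empirical quantile function. -/
def empQuantile {n : ℕ} (x : Fin n → ℝ) : ℝ → ℝ := quantile (empDistFun x)

/-- The grouped variance estimator
`n⁻¹ ∑_J (m_J - 1)⁻¹ #{(k, l) ∈ J × J | x_k ≤ q < x_l}`, where `J` runs over the groups of the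
partition `I`, `m_J` is the size of `J` and `q` is the empirical quantile of level `τ`. -/
def varEst {n : ℕ} (I : Finpartition (Finset.univ : Finset (Fin n))) (x : Fin n → ℝ) (τ : ℝ) :
    ℝ :=
  (n : ℝ)⁻¹ * ∑ J ∈ I.parts, ((J.card : ℝ) - 1)⁻¹ *
    ∑ k ∈ J, ∑ l ∈ J,
      if x k ≤ empQuantile x τ ∧ empQuantile x τ < x l then (1 : ℝ) else 0

/-- The half-width `√(V̂(τ) / n) Φ⁻¹(1 - α / 2)` on the level scale, with `Φ` the standard normal
distribution function. -/
def halfWidth {n : ℕ} (I : Finpartition (Finset.univ : Finset (Fin n))) (x : Fin n → ℝ)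
    (τ α : ℝ) : ℝ :=
  Real.sqrt (varEst I x τ / n) * quantile (fun t => cdf (gaussianReal 0 1) t) (1 - α / 2)

end Sample

end HetQuantile

end

open HetQuantile

/-! Let `q` be the quantile of level `τ` of the average distribution. Continuity gives average
distribution function `τ` at `q`, so `n (F̂(q) - τ)` equals `S`, a sum of independent centered
indicators bounded by 1 with total variance `v = n V(τ) → ∞`. Bounded summands and diverging
variance give a central limit theorem for `S / √v` (`tendsto_charFun_of_bounded_array`).

It remains to show `n V̂ / v → 1` in probability (`measureReal_varEst_ge_le`). With the
deterministic `q` in place of the empirical quantile, each group contributes an unbiased estimator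
of its share of `v`. The groups are independent and the total variance is at most `12 v`, so
Chebyshev's inequality applies. Moving from `q` to the empirical quantile changes the estimator by
at most `2 (1 + |S|)`: it is Lipschitz in the number of observations passed, and without ties `n F̂`
at the empirical quantile is within 1 of `n τ`. Since `S` is of order `√v`, this is negligible
against `v`. A Slutsky argument on characteristic functions (`tendsto_charFun_of_close`) then gives
the limit law.

For the interval, the equivalence between inequalities for a quantile and for its distribution
function turns coverage into the statistic lying in `[-z, z)`, outside a null set and the vanishing
event `V̂ ≤ 0`. -/

namespace HetQuantile
-- Central limit theorem and Slutsky's lemma by characteristic functions.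
section Limit

theorem integrable_of_bounded {Ω : Type*} [MeasurableSpace Ω] {P : Measure Ω} [IsFiniteMeasure P]
    {f : Ω → ℝ} (hf : Measurable f) (C : ℝ) (h : ∀ ω, |f ω| ≤ C) : Integrable f P :=
  Integrable.of_bound hf.aestronglyMeasurable C (Eventually.of_forall h)

/-- Telescoping: factors are exchanged one at a time, the others having norm at most 1. It reduces
the convergence of a product of characteristic functions to a sum of individual errors. -/
theorem norm_prod_sub_prod_le {ι : Type*} (s : Finset ι) (a b : ι → ℂ)
    (ha : ∀ i ∈ s, ‖a i‖ ≤ 1) (hb : ∀ i ∈ s, ‖b i‖ ≤ 1) :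
    ‖∏ i ∈ s, a i - ∏ i ∈ s, b i‖ ≤ ∑ i ∈ s, ‖a i - b i‖ := by
  classical
  induction s using Finset.induction_on with
  | empty => simp
  | insert j s hj ih =>
    rw [Finset.prod_insert hj, Finset.prod_insert hj, Finset.sum_insert hj]
    have hbs : ‖∏ i ∈ s, b i‖ ≤ 1 := by
      rw [norm_prod]
      exact Finset.prod_le_one (fun _ _ => norm_nonneg _)
        fun i hi => hb i (Finset.mem_insert_of_mem hi)
    have ih' := ih (fun i hi => ha i (Finset.mem_insert_of_mem hi))
      (fun i hi => hb i (Finset.mem_insert_of_mem hi))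
    have haj := ha j (Finset.mem_insert_self j s)
    calc ‖a j * ∏ i ∈ s, a i - b j * ∏ i ∈ s, b i‖
        = ‖a j * (∏ i ∈ s, a i - ∏ i ∈ s, b i) + (a j - b j) * ∏ i ∈ s, b i‖ := by
          congr 1; ring
      _ ≤ ‖a j‖ * ‖∏ i ∈ s, a i - ∏ i ∈ s, b i‖ + ‖a j - b j‖ * ‖∏ i ∈ s, b i‖ := by
          rw [← norm_mul, ← norm_mul]; exact norm_add_le _ _
      _ ≤ 1 * ‖∏ i ∈ s, a i - ∏ i ∈ s, b i‖ + ‖a j - b j‖ * 1 := by gcongr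
      _ ≤ _ := by linarith

/-- The second order expansion of the characteristic function of a bounded centered variable. -/
theorem norm_charFun_sub_exp_le {Ω : Type*} [MeasurableSpace Ω] {P : Measure Ω}
    [IsProbabilityMeasure P] {Y : Ω → ℝ} (hY : Measurable Y) (hb : ∀ ω, |Y ω| ≤ 1)
    (h0 : ∫ ω, Y ω ∂P = 0) {u : ℝ} (hu : |u| ≤ 1) :
    ‖charFun (P.map Y) u - Complex.exp ((-(u ^ 2 * ∫ ω, Y ω ^ 2 ∂P) / 2 : ℝ) : ℂ)‖
      ≤ 2 * |u| ^ 3 * ∫ ω, Y ω ^ 2 ∂P := by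
  have hb2 : ∀ ω, Y ω ^ 2 ≤ 1 := fun ω => (sq_le_one_iff_abs_le_one _).2 (hb ω)
  have hi1 : Integrable Y P := integrable_of_bounded hY 1 hb
  have hi2 : Integrable (fun ω => Y ω ^ 2) P :=
    integrable_of_bounded (hY.pow_const 2) 1 fun ω => by
      rw [abs_of_nonneg (sq_nonneg _)]; exact hb2 ω
  set v := ∫ ω, Y ω ^ 2 ∂P with hv
  have hv0 : 0 ≤ v := integral_nonneg fun ω => sq_nonneg _
  have hv1 : v ≤ 1 := by
    have := integral_mono hi2 (integrable_const (1 : ℝ)) hb2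
    simpa using this
  have hie : Integrable (fun ω => Complex.exp (u * Y ω * Complex.I)) P := by
    refine Integrable.of_bound (C := 1) (by fun_prop) (Eventually.of_forall fun ω => ?_)
    rw [← Complex.ofReal_mul, Complex.norm_exp_ofReal_mul_I]
  have key : ‖charFun (P.map Y) u - ((1 - u ^ 2 * v / 2 : ℝ) : ℂ)‖ ≤ |u| ^ 3 * v := by
    have e1 : charFun (P.map Y) u - ((1 - u ^ 2 * v / 2 : ℝ) : ℂ)
        = ∫ ω, (Complex.exp (u * Y ω * Complex.I) -
          (1 + ((u * Y ω : ℝ) : ℂ) * Complex.I - ((u ^ 2 * Y ω ^ 2 / 2 : ℝ) : ℂ))) ∂P := by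
      have hA : Integrable (fun ω => ((u * Y ω : ℝ) : ℂ) * Complex.I) P :=
        ((hi1.const_mul u).ofReal).mul_const _
      have hB : Integrable (fun ω => ((u ^ 2 * Y ω ^ 2 / 2 : ℝ) : ℂ)) P :=
        ((hi2.const_mul (u ^ 2)).div_const 2).ofReal
      have hC : Integrable (fun ω => (1 : ℂ) + ((u * Y ω : ℝ) : ℂ) * Complex.I) P :=
        (integrable_const _).add hA
      have hCB : Integrable (fun ω => (1 : ℂ) + ((u * Y ω : ℝ) : ℂ) * Complex.I -
          ((u ^ 2 * Y ω ^ 2 / 2 : ℝ) : ℂ)) P := hC.sub hB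
      rw [integral_sub hie hCB, integral_sub hC hB,
        integral_add (integrable_const _) hA, integral_mul_const,
        integral_complex_ofReal, integral_complex_ofReal, integral_const_mul, h0,
        integral_div, integral_const_mul, ← hv, charFun_apply_real,
        integral_map hY.aemeasurable (by fun_prop)]
      simp
    rw [e1]
    refine (norm_integral_le_integral_norm _).trans ?_
    rw [← integral_const_mul]
    refine integral_mono_of_nonneg (Eventually.of_forall fun ω => norm_nonneg _)
      (hi2.const_mul _) (Eventually.of_forall fun ω => ?_)
    have hn : ‖((u * Y ω : ℝ) : ℂ) * Complex.I‖ = |u| * |Y ω| := by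
      simp
    have hle : |u| * |Y ω| ≤ 1 := mul_le_one₀ hu (abs_nonneg _) (hb ω)
    have hx := Complex.exp_bound (x := ((u * Y ω : ℝ) : ℂ) * Complex.I) (by rw [hn]; exact hle)
      (n := 3) (by norm_num)
    rw [hn] at hx
    have e2 : Complex.exp (u * Y ω * Complex.I) -
          (1 + ((u * Y ω : ℝ) : ℂ) * Complex.I - ((u ^ 2 * Y ω ^ 2 / 2 : ℝ) : ℂ))
        = Complex.exp (((u * Y ω : ℝ) : ℂ) * Complex.I) -
          ∑ m ∈ Finset.range 3, (((u * Y ω : ℝ) : ℂ) * Complex.I) ^ m / (m.factorial : ℂ) := by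
      simp only [Finset.sum_range_succ, Finset.sum_range_zero]
      push_cast
      simp only [mul_pow, Complex.I_sq, Nat.factorial]
      push_cast
      ring
    simp only
    rw [e2]
    refine hx.trans ?_
    -- Trading the third moment for the second keeps the error proportional to the variance, so that
    -- the errors of the array can be summed.
    have h3 : (|u| * |Y ω|) ^ 3 ≤ |u| ^ 3 * Y ω ^ 2 := by
      have : |Y ω| ^ 3 ≤ Y ω ^ 2 := by
        rw [← sq_abs, pow_succ]
        exact mul_le_of_le_one_right (by positivity) (hb ω)
      rw [mul_pow]; gcongr
    calc (|u| * |Y ω|) ^ 3 * (((3 : ℕ).succ : ℝ) * (((3 : ℕ).factorial : ℝ) * (3 : ℕ))⁻¹)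
        ≤ (|u| * |Y ω|) ^ 3 * 1 := by
          gcongr
          norm_num [Nat.factorial]
      _ ≤ _ := by rw [mul_one]; exact h3
  have hu2 : u ^ 2 ≤ 1 := (sq_le_one_iff_abs_le_one _).2 hu
  have huv : u ^ 2 * v ≤ 1 := mul_le_one₀ hu2 hv0 hv1
  -- Here `|eˣ - 1 - x| ≤ x²` at `x = -u² v / 2`, and `x² = u⁴ v² / 4` is absorbed by `|u|³ v`.
  have key2 : ‖((1 - u ^ 2 * v / 2 : ℝ) : ℂ) - Complex.exp ((-(u ^ 2 * v) / 2 : ℝ) : ℂ)‖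
      ≤ |u| ^ 3 * v := by
    rw [← Complex.ofReal_exp, ← Complex.ofReal_sub, Complex.norm_real, Real.norm_eq_abs,
      abs_sub_comm]
    have h0' : 0 ≤ u ^ 2 * v := by positivity
    have := Real.abs_exp_sub_one_sub_id_le (x := -(u ^ 2 * v) / 2)
      (by rw [abs_le]; constructor <;> linarith)
    calc |Real.exp (-(u ^ 2 * v) / 2) - (1 - u ^ 2 * v / 2)|
        = |Real.exp (-(u ^ 2 * v) / 2) - 1 - -(u ^ 2 * v) / 2| := by congr 1; ring
      _ ≤ _ := this
      _ = (|u| ^ 3 * v) * (|u| * v / 4) := by rw [← sq_abs u]; ring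
      _ ≤ (|u| ^ 3 * v) * 1 := by
          gcongr
          have : |u| * v ≤ 1 := mul_le_one₀ hu hv0 hv1
          linarith
      _ = _ := mul_one _
  calc _ ≤ _ + _ := norm_sub_le_norm_sub_add_norm_sub _ ((1 - u ^ 2 * v / 2 : ℝ) : ℂ) _
    _ ≤ _ := by linarith

variable {Ω : ℕ → Type*} [∀ n, MeasurableSpace (Ω n)] {P : (n : ℕ) → Measure (Ω n)}
  [∀ n, IsProbabilityMeasure (P n)]

/-- The central limit theorem for triangular arrays of bounded centered variables, in terms of
characteristic functions. -/
theorem tendsto_charFun_of_bounded_array {Y : (n : ℕ) → Fin n → Ω n → ℝ}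
    (hY : ∀ n i, Measurable (Y n i)) (hb : ∀ n i ω, |Y n i ω| ≤ 1)
    (h0 : ∀ n i, ∫ ω, Y n i ω ∂(P n) = 0) (hind : ∀ n, iIndepFun (Y n) (P n))
    (hs : Tendsto (fun n => ∑ i, ∫ ω, Y n i ω ^ 2 ∂(P n)) atTop atTop) (t : ℝ) :
    Tendsto (fun n => charFun ((P n).map
        fun ω => (√(∑ i, ∫ ω, Y n i ω ^ 2 ∂(P n)))⁻¹ * ∑ i, Y n i ω) t)
      atTop (𝓝 (Complex.exp (-t ^ 2 / 2))) := by
  set v : (n : ℕ) → Fin n → ℝ := fun n i => ∫ ω, Y n i ω ^ 2 ∂(P n) with hv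
  have hv0 : ∀ n i, 0 ≤ v n i := fun n i => integral_nonneg fun ω => sq_nonneg _
  set s : ℕ → ℝ := fun n => √(∑ i, v n i) with hsdef
  have hst : Tendsto s atTop atTop := Real.tendsto_sqrt_atTop.comp hs
  have hst' : Tendsto (fun n => 2 * |t| ^ 3 * (s n)⁻¹) atTop (𝓝 0) := by
    simpa using (tendsto_inv_atTop_zero.comp hst).const_mul (2 * |t| ^ 3)
  rw [tendsto_iff_norm_sub_tendsto_zero]
  refine squeeze_zero' (Eventually.of_forall fun n => norm_nonneg _) ?_ hst'
  -- From here on `|t| / s ≤ 1`, as the expansion requires. The summed error is `2 (|t| / s)³ s² = 2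
  -- |t|³ / s`.
  filter_upwards [hst.eventually_ge_atTop (|t| + 1)] with n hn
  have hspos : 0 < s n := by have := abs_nonneg t; linarith
  have hss : s n ^ 2 = ∑ i, v n i := Real.sq_sqrt (Finset.sum_nonneg fun i _ => hv0 n i)
  have hu : |(s n)⁻¹ * t| ≤ 1 := by
    rw [abs_mul, abs_inv, abs_of_pos hspos, inv_mul_le_one₀ hspos]; linarith
  have e1 : charFun ((P n).map fun ω => (s n)⁻¹ * ∑ i, Y n i ω) t
      = ∏ i, charFun ((P n).map (Y n i)) ((s n)⁻¹ * t) := by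
    rw [charFun_map_mul_comp, iIndepFun.charFun_map_fun_sum_eq_prod
      (fun i => (hY n i).aemeasurable) (hind n), Finset.prod_apply]
    exact Finset.aemeasurable_fun_sum _ fun i _ => (hY n i).aemeasurable
  have e2 : Complex.exp (-t ^ 2 / 2)
      = ∏ i, Complex.exp ((-(((s n)⁻¹ * t) ^ 2 * v n i) / 2 : ℝ) : ℂ) := by
    rw [← Complex.exp_sum, ← Complex.ofReal_sum, ← Finset.sum_div, Finset.sum_neg_distrib,
      ← Finset.mul_sum, ← hss, mul_pow, inv_pow]
    congr 1
    have : (s n) ^ 2 ≠ 0 := by positivity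
    rw [show ((s n ^ 2)⁻¹ * t ^ 2 * s n ^ 2 : ℝ) = t ^ 2 by field_simp]
    push_cast; ring
  rw [e1, e2]
  refine (norm_prod_sub_prod_le _ _ _ (fun i _ => ?_) fun i _ => ?_).trans ?_
  · have := Measure.isProbabilityMeasure_map (μ := P n) (hY n i).aemeasurable
    exact norm_charFun_le_one _
  · rw [← Complex.ofReal_exp, Complex.norm_real, Real.norm_eq_abs, Real.abs_exp,
      Real.exp_le_one_iff]
    have : 0 ≤ ((s n)⁻¹ * t) ^ 2 * v n i := mul_nonneg (sq_nonneg _) (hv0 n i)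
    linarith
  · refine (Finset.sum_le_sum fun i _ =>
      norm_charFun_sub_exp_le (hY n i) (hb n i) (h0 n i) hu).trans ?_
    rw [← Finset.mul_sum]
    change 2 * |(s n)⁻¹ * t| ^ 3 * ∑ i, v n i ≤ _
    rw [← hss, abs_mul, abs_inv, abs_of_pos hspos]
    refine le_of_eq ?_
    field_simp

/-- Characteristic functions of variables which are asymptotically equal in probability have the
same limit. -/
theorem tendsto_charFun_of_close {Z T : (n : ℕ) → Ω n → ℝ} (hZ : ∀ n, Measurable (Z n))
    (hT : ∀ n, AEMeasurable (T n) (P n)) {t : ℝ} {φ : ℂ}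
    (h : Tendsto (fun n => charFun ((P n).map (Z n)) t) atTop (𝓝 φ))
    (hclose : ∀ ε > 0, Tendsto (fun n => (P n).real {ω | ε ≤ |T n ω - Z n ω|}) atTop (𝓝 0)) :
    Tendsto (fun n => charFun ((P n).map (T n)) t) atTop (𝓝 φ) := by
  suffices hd : Tendsto (fun n => charFun ((P n).map (T n)) t - charFun ((P n).map (Z n)) t)
      atTop (𝓝 0) by simpa using hd.add h
  rw [Metric.tendsto_atTop']
  intro η hη
  -- The difference is at most `|t| ε` off the bad event and 2 on it; this `ε` and probability below
  -- `η / 4` make each part at most `η / 2`.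
  set ε := η / (2 * (|t| + 1)) with hε
  have hεpos : 0 < ε := by positivity
  have hev := (hclose ε hεpos).eventually_lt_const (show (0 : ℝ) < η / 4 by positivity)
  obtain ⟨N, hN⟩ := eventually_atTop.1 hev
  refine ⟨N, fun n hn => ?_⟩
  rw [dist_zero_right]
  have hmeas : NullMeasurableSet {ω | ε ≤ |T n ω - Z n ω|} (P n) :=
    nullMeasurableSet_le aemeasurable_const ((hT n).sub (hZ n).aemeasurable).abs
  set A := {ω | ε ≤ |T n ω - Z n ω|} with hA
  have hint : ∀ {U : Ω n → ℝ}, AEMeasurable U (P n) →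
      Integrable (fun ω => Complex.exp (t * U ω * Complex.I)) (P n) := fun {U} hU => by
    refine Integrable.of_bound (C := 1) (by fun_prop) (Eventually.of_forall fun ω => ?_)
    rw [← Complex.ofReal_mul, Complex.norm_exp_ofReal_mul_I]
  rw [charFun_apply_real, charFun_apply_real, integral_map (hT n) (by fun_prop),
    integral_map (hZ n).aemeasurable (by fun_prop),
    ← integral_sub (hint (hT n)) (hint (hZ n).aemeasurable)]
  have hbd : ∀ ω, ‖Complex.exp (t * T n ω * Complex.I) - Complex.exp (t * Z n ω * Complex.I)‖
      ≤ |t| * ε + A.indicator (fun _ => (2 : ℝ)) ω := by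
    intro ω
    by_cases hω : ω ∈ A
    · rw [Set.indicator_of_mem hω]
      refine (norm_sub_le _ _).trans ?_
      rw [← Complex.ofReal_mul, ← Complex.ofReal_mul, Complex.norm_exp_ofReal_mul_I,
        Complex.norm_exp_ofReal_mul_I]
      have : 0 ≤ |t| * ε := by positivity
      linarith
    · rw [Set.indicator_of_notMem hω, add_zero]
      have hlt : |T n ω - Z n ω| < ε := not_le.1 hω
      have e : Complex.exp (t * T n ω * Complex.I) - Complex.exp (t * Z n ω * Complex.I)
          = Complex.exp ((t * Z n ω : ℝ) * Complex.I) *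
            (Complex.exp (Complex.I * ((t * (T n ω - Z n ω) : ℝ) : ℂ)) - 1) := by
        rw [mul_sub, ← Complex.exp_add, mul_one]
        push_cast; congr 2; ring_nf
      rw [e, norm_mul, Complex.norm_exp_ofReal_mul_I, one_mul]
      refine Real.norm_exp_I_mul_ofReal_sub_one_le.trans ?_
      rw [Real.norm_eq_abs, abs_mul]
      gcongr
  refine (norm_integral_le_integral_norm _).trans_lt ?_
  refine (integral_mono_of_nonneg (Eventually.of_forall fun ω => norm_nonneg _) ?_
    (Eventually.of_forall hbd)).trans_lt ?_
  · exact (integrable_const _).add ((integrable_const _).indicator₀ hmeas)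
  · rw [integral_add (integrable_const _) ((integrable_const _).indicator₀ hmeas),
      integral_indicator₀ hmeas]
    simp only [integral_const, smul_eq_mul, probReal_univ, one_mul, measureReal_restrict_apply_univ]
    have h1 := hN n hn.le
    have h2 : |t| * ε ≤ η / 2 := by
      rw [hε, mul_div_assoc', div_le_div_iff₀ (by positivity) (by positivity)]
      nlinarith [abs_nonneg t]
    linarith
end Limit
end HetQuantile

namespace HetQuantile
-- Moments of sums of centered indicators and of the group statistics.
noncomputable section Moments

variable {Ω : Type*} [MeasurableSpace Ω] {P : Measure Ω}

/-- Induction on the index set: in the binomial expansion every term with a first power of `S` or of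
the new variable vanishes. The fourth moment gains `6 V v + E ξ⁴`, with `E ξ⁴ ≤ v` by boundedness,
and `3 (V + v)²` absorbs the cross term. -/
theorem integral_sum_pow_of_indep [IsProbabilityMeasure P] {ι : Type*} {ξ : ι → Ω → ℝ} (hξ : ∀ i, Measurable (ξ i))
    (hb : ∀ i ω, |ξ i ω| ≤ 1) (h0 : ∀ i, ∫ ω, ξ i ω ∂P = 0) (hind : iIndepFun ξ P)
    (s : Finset ι) :
    ∫ ω, (∑ i ∈ s, ξ i ω) ∂P = 0 ∧
    ∫ ω, (∑ i ∈ s, ξ i ω) ^ 2 ∂P = ∑ i ∈ s, ∫ ω, ξ i ω ^ 2 ∂P ∧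
    ∫ ω, (∑ i ∈ s, ξ i ω) ^ 4 ∂P ≤ ∑ i ∈ s, ∫ ω, ξ i ω ^ 2 ∂P +
      3 * (∑ i ∈ s, ∫ ω, ξ i ω ^ 2 ∂P) ^ 2 := by
  classical
  induction s using Finset.induction_on with
  | empty => simp
  | insert j s hj ih =>
    obtain ⟨ih1, ih2, ih4⟩ := ih
    set S : Ω → ℝ := fun ω => ∑ i ∈ s, ξ i ω with hS
    have hSm : Measurable S := Finset.measurable_sum _ fun i _ => hξ i
    have hSb : ∀ ω, |S ω| ≤ s.card := fun ω =>
      (Finset.abs_sum_le_sum_abs _ _).trans ((Finset.sum_le_sum fun i _ => hb i ω).trans (by simp))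
    have hSind : IndepFun S (ξ j) P := by
      have := hind.indepFun_finsetSum_of_notMem hξ hj
      rwa [show (∑ i ∈ s, ξ i) = S from by ext ω; simp [hS]] at this
    have hint : ∀ a b : ℕ, Integrable (fun ω => S ω ^ a * ξ j ω ^ b) P := fun a b => by
      refine integrable_of_bounded (by fun_prop) ((s.card : ℝ) ^ a * 1) fun ω => ?_
      rw [abs_mul, abs_pow, abs_pow]
      exact mul_le_mul (pow_le_pow_left₀ (abs_nonneg _) (hSb ω) _)
        (pow_le_one₀ (abs_nonneg _) (hb j ω)) (by positivity) (by positivity)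
    have hprod : ∀ a b : ℕ, ∫ ω, S ω ^ a * ξ j ω ^ b ∂P
        = (∫ ω, S ω ^ a ∂P) * ∫ ω, ξ j ω ^ b ∂P := fun a b =>
      IndepFun.integral_fun_comp_mul_comp (f := fun x : ℝ => x ^ a) (g := fun x : ℝ => x ^ b)
        hSind hSm.aemeasurable (hξ j).aemeasurable (by fun_prop) (by fun_prop)
    have hS1 : ∫ ω, S ω ^ 1 ∂P = 0 := by simpa using ih1
    have hξ1 : ∫ ω, ξ j ω ^ 1 ∂P = 0 := by simpa using h0 j
    set v := ∫ ω, ξ j ω ^ 2 ∂P with hv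
    have hv4 : ∫ ω, ξ j ω ^ 4 ∂P ≤ v := by
      refine integral_mono (by simpa using hint 0 4) (by simpa using hint 0 2) fun ω => ?_
      have h2 : ξ j ω ^ 2 ≤ 1 := (sq_le_one_iff_abs_le_one _).2 (hb j ω)
      simp only
      nlinarith [sq_nonneg (ξ j ω)]
    have hins : ∀ ω, ∑ i ∈ insert j s, ξ i ω = S ω + ξ j ω := fun ω => by
      rw [Finset.sum_insert hj, add_comm]
    simp only [hins, Finset.sum_insert hj]
    refine ⟨?_, ?_, ?_⟩
    · rw [integral_add (by simpa using hint 1 0) (by simpa using hint 0 1), ih1, h0 j, add_zero]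
    -- Zeroth powers are kept so that every term has the form `S ^ a * ξ ^ b` handled by `hint` and
    -- `hprod`.
    · have e : ∀ ω, (S ω + ξ j ω) ^ 2
          = S ω ^ 2 * ξ j ω ^ 0 + 2 * (S ω ^ 1 * ξ j ω ^ 1) + S ω ^ 0 * ξ j ω ^ 2 :=
        fun ω => by ring
      simp only [e]
      have i1 : Integrable (fun ω => S ω ^ 2 * ξ j ω ^ 0 + 2 * (S ω ^ 1 * ξ j ω ^ 1)) P :=
        (hint 2 0).add ((hint 1 1).const_mul 2)
      rw [integral_add i1 (hint 0 2),
        integral_add (hint 2 0) ((hint 1 1).const_mul 2), integral_const_mul,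
        hprod, hprod, hprod, hS1, ih2, ← hv]
      simp
      ring
    · have e : ∀ ω, (S ω + ξ j ω) ^ 4
          = S ω ^ 4 * ξ j ω ^ 0 + 4 * (S ω ^ 3 * ξ j ω ^ 1) + 6 * (S ω ^ 2 * ξ j ω ^ 2)
            + 4 * (S ω ^ 1 * ξ j ω ^ 3) + S ω ^ 0 * ξ j ω ^ 4 :=
        fun ω => by ring
      simp only [e]
      have i1 : Integrable (fun ω => S ω ^ 4 * ξ j ω ^ 0 + 4 * (S ω ^ 3 * ξ j ω ^ 1)) P :=
        (hint 4 0).add ((hint 3 1).const_mul 4)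
      have i2 : Integrable (fun ω => S ω ^ 4 * ξ j ω ^ 0 + 4 * (S ω ^ 3 * ξ j ω ^ 1)
          + 6 * (S ω ^ 2 * ξ j ω ^ 2)) P := i1.add ((hint 2 2).const_mul 6)
      have i3 : Integrable (fun ω => S ω ^ 4 * ξ j ω ^ 0 + 4 * (S ω ^ 3 * ξ j ω ^ 1)
          + 6 * (S ω ^ 2 * ξ j ω ^ 2) + 4 * (S ω ^ 1 * ξ j ω ^ 3)) P :=
        i2.add ((hint 1 3).const_mul 4)
      rw [integral_add i3 (hint 0 4), integral_add i2 ((hint 1 3).const_mul 4),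
        integral_add i1 ((hint 2 2).const_mul 6), integral_add (hint 4 0) ((hint 3 1).const_mul 4),
        integral_const_mul, integral_const_mul, integral_const_mul,
        hprod, hprod, hprod, hprod, hprod, hS1, hξ1, ih2, ← hv]
      simp
      nlinarith [sq_nonneg v]

/-- The centered indicator of the event `Y ≤ q`. -/
def centeredInd (P : Measure Ω) (Y : Ω → ℝ) (q : ℝ) (ω : Ω) : ℝ :=
  (if Y ω ≤ q then (1 : ℝ) else 0) - distFun P Y q

theorem measurable_ind {Y : Ω → ℝ} (hY : Measurable Y) (q : ℝ) :
    Measurable fun ω => if Y ω ≤ q then (1 : ℝ) else 0 :=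
  Measurable.ite (measurableSet_le hY measurable_const) measurable_const measurable_const

theorem distFun_nonneg (Y : Ω → ℝ) (q : ℝ) : 0 ≤ distFun P Y q := cdf_nonneg _ _

theorem distFun_le_one (Y : Ω → ℝ) (q : ℝ) : distFun P Y q ≤ 1 := cdf_le_one _ _

theorem distFun_eq_real [IsProbabilityMeasure P] {Y : Ω → ℝ} (hY : Measurable Y) (q : ℝ) :
    distFun P Y q = P.real {ω | Y ω ≤ q} := by
  have := Measure.isProbabilityMeasure_map (μ := P) hY.aemeasurable
  rw [distFun, cdf_eq_real, map_measureReal_apply hY measurableSet_Iic]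
  rfl

theorem integral_ind [IsProbabilityMeasure P] {Y : Ω → ℝ} (hY : Measurable Y) (q : ℝ) :
    ∫ ω, (if Y ω ≤ q then (1 : ℝ) else 0) ∂P = distFun P Y q := by
  rw [distFun_eq_real hY, ← integral_indicator_one (measurableSet_le hY measurable_const)]
  congr 1

theorem measurable_centeredInd {Y : Ω → ℝ} (hY : Measurable Y) (q : ℝ) :
    Measurable (centeredInd P Y q) := (measurable_ind hY q).sub_const _

theorem abs_centeredInd_le (Y : Ω → ℝ) (q : ℝ) (ω : Ω) : |centeredInd P Y q ω| ≤ 1 := by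
  have h0 := distFun_nonneg (P := P) Y q
  have h1 := distFun_le_one (P := P) Y q
  rw [centeredInd, abs_le]
  split_ifs <;> constructor <;> linarith

theorem integrable_ind [IsProbabilityMeasure P] {Y : Ω → ℝ} (hY : Measurable Y) (q : ℝ) :
    Integrable (fun ω => if Y ω ≤ q then (1 : ℝ) else 0) P :=
  integrable_of_bounded (measurable_ind hY q) 1 fun ω => by split_ifs <;> simp

theorem integral_centeredInd [IsProbabilityMeasure P] {Y : Ω → ℝ} (hY : Measurable Y) (q : ℝ) :
    ∫ ω, centeredInd P Y q ω ∂P = 0 := by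
  unfold centeredInd
  rw [integral_sub (integrable_ind hY q) (integrable_const _), integral_ind hY]
  simp

theorem integral_centeredInd_sq [IsProbabilityMeasure P] {Y : Ω → ℝ} (hY : Measurable Y) (q : ℝ) :
    ∫ ω, centeredInd P Y q ω ^ 2 ∂P = distFun P Y q * (1 - distFun P Y q) := by
  have e : ∀ ω, centeredInd P Y q ω ^ 2
      = (1 - 2 * distFun P Y q) * (if Y ω ≤ q then (1 : ℝ) else 0) + distFun P Y q ^ 2 := by
    intro ω; unfold centeredInd; split_ifs <;> ring
  simp only [e]
  rw [integral_add ((integrable_ind hY q).const_mul _) (integrable_const _), integral_const_mul,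
    integral_ind hY]
  simp
  ring

theorem iIndepFun_centeredInd {ι : Type*} {X : ι → Ω → ℝ} (hind : iIndepFun X P) (q : ℝ) :
    iIndepFun (fun i => centeredInd P (X i) q) P :=
  hind.comp (fun i x => (if x ≤ q then (1 : ℝ) else 0) - distFun P (X i) q)
    fun _ => (measurable_ind measurable_id q).sub_const _

/-- The number of points of the group `J` which are at most `q`. -/
def groupCount {ι : Type*} (J : Finset ι) (x : ι → ℝ) (q : ℝ) : ℝ :=
  ∑ k ∈ J, if x k ≤ q then (1 : ℝ) else 0

/-- The contribution of the group `J` to the variance estimator. -/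
def groupStat {ι : Type*} (J : Finset ι) (x : ι → ℝ) (q : ℝ) : ℝ :=
  ((J.card : ℝ) - 1)⁻¹ * (groupCount J x q * (J.card - groupCount J x q))

theorem sum_sum_ite_eq {ι : Type*} (J : Finset ι) (x : ι → ℝ) (q : ℝ) :
    ∑ k ∈ J, ∑ l ∈ J, (if x k ≤ q ∧ q < x l then (1 : ℝ) else 0)
      = groupCount J x q * (J.card - groupCount J x q) := by
  have h : (J.card : ℝ) - groupCount J x q = ∑ l ∈ J, if q < x l then (1 : ℝ) else 0 := by
    rw [groupCount, Finset.card_eq_sum_ones]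
    push_cast
    rw [← Finset.sum_sub_distrib]
    refine Finset.sum_congr rfl fun l _ => ?_
    by_cases hl : x l ≤ q
    · simp [hl, not_lt.2 hl]
    · simp [hl, not_le.1 hl]
  rw [h, groupCount, Finset.sum_mul_sum]
  refine Finset.sum_congr rfl fun k _ => Finset.sum_congr rfl fun l _ => ?_
  by_cases hk : x k ≤ q <;> simp [hk]

theorem groupCount_nonneg {ι : Type*} (J : Finset ι) (x : ι → ℝ) (q : ℝ) :
    0 ≤ groupCount J x q := Finset.sum_nonneg fun _ _ => by split_ifs <;> simp

theorem groupCount_le_card {ι : Type*} (J : Finset ι) (x : ι → ℝ) (q : ℝ) :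
    groupCount J x q ≤ J.card := by
  rw [Finset.card_eq_sum_ones]
  push_cast
  exact Finset.sum_le_sum fun _ _ => by split_ifs <;> simp

theorem groupStat_nonneg {ι : Type*} {J : Finset ι} (hJ : 2 ≤ J.card) (x : ι → ℝ) (q : ℝ) :
    0 ≤ groupStat J x q := by
  have h2 : (2 : ℝ) ≤ J.card := by exact_mod_cast hJ
  have := groupCount_nonneg J x q
  have := groupCount_le_card J x q
  exact mul_nonneg (inv_nonneg.2 (by linarith)) (mul_nonneg (by linarith) (by linarith))

theorem groupStat_le {ι : Type*} {J : Finset ι} (hJ : 2 ≤ J.card) (x : ι → ℝ) (q : ℝ) :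
    groupStat J x q ≤ J.card / 2 := by
  have h2 : (2 : ℝ) ≤ J.card := by exact_mod_cast hJ
  rw [groupStat, inv_mul_le_iff₀ (by linarith)]
  nlinarith [sq_nonneg ((J.card : ℝ) - 2 * groupCount J x q)]

theorem measurable_groupStat {ι : Type*} {X : ι → Ω → ℝ} (hX : ∀ i, Measurable (X i))
    (J : Finset ι) (q : ℝ) : Measurable fun ω => groupStat J (fun i => X i ω) q := by
  have : Measurable fun ω => groupCount J (fun i => X i ω) q :=
    Finset.measurable_sum _ fun i _ => measurable_ind (hX i) q
  unfold groupStat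
  fun_prop

/-- Mean and variance bound of the contribution of one group. -/
theorem groupStat_moments [IsProbabilityMeasure P] {ι : Type*} {X : ι → Ω → ℝ} (hX : ∀ i, Measurable (X i))
    (hind : iIndepFun X P) {J : Finset ι} (hJ : 2 ≤ J.card) {q p : ℝ}
    (hp : ∀ i ∈ J, distFun P (X i) q = p) :
    ∫ ω, groupStat J (fun i => X i ω) q ∂P = J.card * (p * (1 - p)) ∧
    Var[fun ω => groupStat J (fun i => X i ω) q; P] ≤ 12 * (J.card * (p * (1 - p))) := by
  have h2 : (2 : ℝ) ≤ J.card := by exact_mod_cast hJ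
  obtain ⟨j, hj⟩ : J.Nonempty := Finset.card_pos.1 (by omega)
  have hp0 : 0 ≤ p := hp j hj ▸ distFun_nonneg _ _
  have hp1 : p ≤ 1 := hp j hj ▸ distFun_le_one _ _
  obtain ⟨hm1, hm2, hm4⟩ := integral_sum_pow_of_indep
    (fun i => measurable_centeredInd (P := P) (hX i) q)
    (fun i ω => abs_centeredInd_le (X i) q ω) (fun i => integral_centeredInd (hX i) q)
    (iIndepFun_centeredInd hind q) J
  have hsum : ∑ i ∈ J, ∫ ω, centeredInd P (X i) q ω ^ 2 ∂P = J.card * (p * (1 - p)) := by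
    rw [Finset.sum_congr rfl fun i hi => by rw [integral_centeredInd_sq (hX i), hp i hi]]
    simp
  rw [hsum] at hm2 hm4
  set m : ℝ := (J.card : ℝ) with hm
  set S : Ω → ℝ := fun ω => ∑ i ∈ J, centeredInd P (X i) q ω with hS
  have hcount : ∀ ω, groupCount J (fun i => X i ω) q = m * p + S ω := fun ω => by
    simp only [hS, centeredInd, Finset.sum_sub_distrib, groupCount]
    rw [Finset.sum_congr rfl hp]
    simp [← hm]
  have hSm : Measurable S := Finset.measurable_sum _ fun i _ => measurable_centeredInd (hX i) q
  have hSb : ∀ ω, |S ω| ≤ m := fun ω =>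
    (Finset.abs_sum_le_sum_abs _ _).trans
      ((Finset.sum_le_sum fun i _ => abs_centeredInd_le _ _ _).trans (by simp [← hm]))
  have hint : ∀ a : ℕ, Integrable (fun ω => S ω ^ a) P := fun a => by
    refine integrable_of_bounded (by fun_prop) (m ^ a) fun ω => ?_
    rw [abs_pow]
    exact pow_le_pow_left₀ (abs_nonneg _) (hSb ω) _
  have hm1' : ∫ ω, S ω ^ 1 ∂P = 0 := by simpa using hm1
  set w := p * (1 - p) with hw
  have hw0 : 0 ≤ w := mul_nonneg hp0 (by linarith)
  have hw4 : w ≤ 1 / 4 := by rw [hw]; nlinarith [sq_nonneg (1 - 2 * p)]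
  have hmm : m - 1 ≠ 0 := by linarith
  -- With count `N = m p + S`, one has `N (m - N) = m² w + m (1 - 2 p) S - S²`. Since `E S² = m w`,
  -- its mean is `m (m - 1) w`; the divisor `m - 1` makes the statistic unbiased.
  have hstat : ∀ ω, groupStat J (fun i => X i ω) q
      = m ^ 2 * w / (m - 1) + (m * (1 - 2 * p) / (m - 1)) * S ω ^ 1
        - (m - 1)⁻¹ * S ω ^ 2 := fun ω => by
    rw [groupStat, hcount, hw, ← hm]; field_simp; ring
  have hmean : ∫ ω, groupStat J (fun i => X i ω) q ∂P = m * w := by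
    simp only [hstat]
    have i1 : Integrable (fun ω => m ^ 2 * w / (m - 1) + (m * (1 - 2 * p) / (m - 1)) * S ω ^ 1) P :=
      (integrable_const _).add ((hint 1).const_mul _)
    rw [integral_sub i1 ((hint 2).const_mul _),
      integral_add (integrable_const _) ((hint 1).const_mul _), integral_const_mul,
      integral_const_mul, hm1', hm2]
    simp
    field_simp
  refine ⟨hmean, ?_⟩
  rw [variance_eq_integral (measurable_groupStat hX J q).aemeasurable, hmean]
  set c := 2 * ((m - 1) ^ 2)⁻¹ with hc
  have hc0 : 0 ≤ c := by positivity
  have hpt : ∀ ω, (groupStat J (fun i => X i ω) q - m * w) ^ 2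
      ≤ c * (m ^ 2 * S ω ^ 2 + S ω ^ 4 - 2 * m * w * S ω ^ 2 + m ^ 2 * w ^ 2) := fun ω => by
    have e : groupStat J (fun i => X i ω) q - m * w
        = (m - 1)⁻¹ * (m * (1 - 2 * p) * S ω - (S ω ^ 2 - m * w)) := by
      rw [hstat]; field_simp; ring
    have h1 : (1 - 2 * p) ^ 2 ≤ 1 := by nlinarith
    have h2 : (1 - 2 * p) ^ 2 * (m ^ 2 * S ω ^ 2) ≤ 1 * (m ^ 2 * S ω ^ 2) := by gcongr
    -- This is `(a - b)² ≤ 2 a² + 2 b²` together with `(1 - 2 p)² ≤ 1`.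
    have key : (m * (1 - 2 * p) * S ω - (S ω ^ 2 - m * w)) ^ 2
        ≤ 2 * (m ^ 2 * S ω ^ 2 + S ω ^ 4 - 2 * m * w * S ω ^ 2 + m ^ 2 * w ^ 2) := by
      nlinarith [sq_nonneg (m * (1 - 2 * p) * S ω + (S ω ^ 2 - m * w))]
    have := mul_le_mul_of_nonneg_left key (inv_nonneg.2 (sq_nonneg (m - 1)))
    rw [e, mul_pow, inv_pow, hc]
    linarith
  have hi2 := hint 2
  have hi4 := hint 4
  have j1 : Integrable (fun ω => m ^ 2 * S ω ^ 2 + S ω ^ 4) P := (hi2.const_mul _).add hi4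
  have j2 : Integrable (fun ω => m ^ 2 * S ω ^ 2 + S ω ^ 4 - 2 * m * w * S ω ^ 2) P :=
    j1.sub (hi2.const_mul _)
  have j3 : Integrable (fun ω => m ^ 2 * S ω ^ 2 + S ω ^ 4 - 2 * m * w * S ω ^ 2
      + m ^ 2 * w ^ 2) P := j2.add (integrable_const _)
  refine (integral_mono_of_nonneg (Eventually.of_forall fun ω => sq_nonneg _)
    (j3.const_mul c) (Eventually.of_forall hpt)).trans ?_
  rw [integral_const_mul, integral_add j2 (integrable_const _), integral_sub j1 (hi2.const_mul _),
    integral_add (hi2.const_mul _) hi4, integral_const_mul, integral_const_mul]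
  change c * (m ^ 2 * (∫ ω, S ω ^ 2 ∂P) + (∫ ω, S ω ^ 4 ∂P) - 2 * m * w * (∫ ω, S ω ^ 2 ∂P) + _) ≤ _
  change ∫ ω, S ω ^ 2 ∂P = _ at hm2
  change ∫ ω, S ω ^ 4 ∂P ≤ _ at hm4
  rw [hm2, integral_const, probReal_univ, one_smul]
  calc c * (m ^ 2 * (m * w) + (∫ ω, S ω ^ 4 ∂P) - 2 * m * w * (m * w) + m ^ 2 * w ^ 2)
      ≤ c * (m ^ 2 * (m * w) + (m * w + 3 * (m * w) ^ 2) - 2 * m * w * (m * w) + m ^ 2 * w ^ 2) := by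
        gcongr
    _ = c * (m ^ 2 + 1 + 2 * m * w) * (m * w) := by ring
    _ ≤ 12 * (m * w) := by
        refine mul_le_mul_of_nonneg_right ?_ (by positivity)
        have hpos : 0 < (m - 1) ^ 2 := by have : 0 < m - 1 := by linarith
                                          positivity
        -- With `w ≤ 1 / 4` the claim becomes `2 (m² + 1 + m / 2) ≤ 12 (m - 1)²`, an equality at `m
        -- = 2`; this is the source of the constant 12.
        rw [hc, mul_assoc, inv_mul_eq_div, mul_div_assoc', div_le_iff₀ hpos]
        nlinarith [mul_le_mul_of_nonneg_left hw4 (show 0 ≤ m by linarith)]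

theorem measurable_sum_groupStat {n : ℕ} {X : Fin n → Ω → ℝ} (hX : ∀ i, Measurable (X i))
    (s : Finset (Finset (Fin n))) (q : ℝ) :
    Measurable fun ω => ∑ J ∈ s, groupStat J (fun i => X i ω) q :=
  Finset.measurable_sum _ fun J _ => measurable_groupStat hX J q

theorem sum_groupStat_moments [IsProbabilityMeasure P] {n : ℕ} {X : Fin n → Ω → ℝ} (hX : ∀ i, Measurable (X i))
    (hind : iIndepFun X P) (I : Finpartition (Finset.univ : Finset (Fin n)))
    (hcard : ∀ J ∈ I.parts, 2 ≤ J.card)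
    (hident : ∀ J ∈ I.parts, ∀ i ∈ J, ∀ i' ∈ J, distFun P (X i) = distFun P (X i')) (q : ℝ) :
    ∫ ω, (∑ J ∈ I.parts, groupStat J (fun i => X i ω) q) ∂P
      = ∑ i, distFun P (X i) q * (1 - distFun P (X i) q) ∧
    Var[fun ω => ∑ J ∈ I.parts, groupStat J (fun i => X i ω) q; P]
      ≤ 12 * ∑ i, distFun P (X i) q * (1 - distFun P (X i) q) := by
  have hgroup : ∀ J ∈ I.parts,
      ∫ ω, groupStat J (fun i => X i ω) q ∂P
        = ∑ i ∈ J, distFun P (X i) q * (1 - distFun P (X i) q) ∧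
      Var[fun ω => groupStat J (fun i => X i ω) q; P]
        ≤ 12 * ∑ i ∈ J, distFun P (X i) q * (1 - distFun P (X i) q) := by
    intro J hJ
    obtain ⟨j, hj⟩ : J.Nonempty := Finset.card_pos.1 (by have := hcard J hJ; omega)
    have hp : ∀ i ∈ J, distFun P (X i) q = distFun P (X j) q := fun i hi => by
      rw [hident J hJ i hi j hj]
    have e : ∑ i ∈ J, distFun P (X i) q * (1 - distFun P (X i) q)
        = J.card * (distFun P (X j) q * (1 - distFun P (X j) q)) := by
      rw [Finset.sum_congr rfl fun i hi => by rw [hp i hi]]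
      simp
    rw [e]
    exact groupStat_moments hX hind (hcard J hJ) hp
  have hsum : ∑ i, distFun P (X i) q * (1 - distFun P (X i) q)
      = ∑ J ∈ I.parts, ∑ i ∈ J, distFun P (X i) q * (1 - distFun P (X i) q) := by
    have h := Finset.sum_biUnion (s := I.parts) (t := id)
      (f := fun i => distFun P (X i) q * (1 - distFun P (X i) q)) I.disjoint
    rwa [I.biUnion_parts] at h
  have hbd : ∀ J ∈ I.parts, ∀ ω, |groupStat J (fun i => X i ω) q| ≤ J.card / 2 := fun J hJ ω => by
    rw [abs_of_nonneg (groupStat_nonneg (hcard J hJ) _ _)]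
    exact groupStat_le (hcard J hJ) _ _
  rw [hsum]
  constructor
  · rw [integral_finsetSum _ fun J hJ =>
      integrable_of_bounded (measurable_groupStat hX J q) _ (hbd J hJ)]
    exact Finset.sum_congr rfl fun J hJ => (hgroup J hJ).1
  · have e : (fun ω => ∑ J ∈ I.parts, groupStat J (fun i => X i ω) q)
        = ∑ J ∈ I.parts, fun ω => groupStat J (fun i => X i ω) q := by
      ext ω; simp
    rw [e, IndepFun.variance_sum, Finset.mul_sum]
    · exact Finset.sum_le_sum fun J hJ => (hgroup J hJ).2
    · exact fun J hJ => MemLp.of_bound (measurable_groupStat hX J q).aestronglyMeasurable _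
        (Eventually.of_forall (hbd J hJ))
    · intro J hJ K hK hJK
      have hd : Disjoint J K := I.disjoint hJ hK hJK
      -- Each statistic depends only on the coordinates in its own group, so disjoint groups give
      -- independent statistics.
      have hst : ∀ L : Finset (Fin n), (fun ω => groupStat L (fun i => X i ω) q)
          = (fun y : L → ℝ => groupStat Finset.univ y q) ∘ fun ω (i : L) => X i ω := by
        intro L
        ext ω
        simp only [groupStat, groupCount, Function.comp, Finset.card_univ, Fintype.card_coe]
        rw [Finset.sum_coe_sort L fun k => if X k ω ≤ q then (1 : ℝ) else 0]
      have hms : ∀ L : Finset (Fin n), Measurable fun y : L → ℝ => groupStat Finset.univ y q :=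
        fun L => measurable_groupStat (fun i => measurable_pi_apply i) _ q
      change IndepFun _ _ P
      rw [hst J, hst K]
      exact (hind.indepFun_finset J K hd hX).comp (hms J) (hms K)
end Moments
end HetQuantile

namespace HetQuantile
-- Quantile functions and deterministic properties of the empirical quantile.
section Quantile

/-- Right continuity makes the infimum attained. The two existence hypotheses rule out default
values of `sInf` on sets that are empty or unbounded below. -/
theorem quantile_le_iff {F : ℝ → ℝ} {u : ℝ} (hF : Monotone F)
    (hrc : ∀ x, ContinuousWithinAt F (Set.Ici x) x) (hlow : ∃ x, F x < u) (hup : ∃ x, u ≤ F x)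
    {t : ℝ} : quantile F u ≤ t ↔ u ≤ F t := by
  have hbdd : BddBelow {x | u ≤ F x} := by
    obtain ⟨y, hy⟩ := hlow
    refine ⟨y, fun x hx => le_of_not_gt fun hxy => ?_⟩
    exact (hy.trans_le hx).not_ge (hF hxy.le)
  refine ⟨fun h => ?_, fun h => csInf_le hbdd h⟩
  refine le_trans ?_ (hF h)
  by_contra! hlt
  have hev : ∀ᶠ y in 𝓝[>] (quantile F u), F y < u :=
    ((hrc _).mono Set.Ioi_subset_Ici_self).eventually_lt_const hlt
  obtain ⟨y, hy, hqy⟩ := (hev.and self_mem_nhdsWithin).exists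
  obtain ⟨s, hs, hsy⟩ := exists_lt_of_csInf_lt hup hqy
  exact (hy.trans_le hs).not_ge (hF hsy.le)

theorem apply_quantile {F : ℝ → ℝ} {u : ℝ} (hF : Monotone F) (hc : Continuous F)
    (hlow : ∃ x, F x < u) (hup : ∃ x, u ≤ F x) : F (quantile F u) = u := by
  have h := fun t => quantile_le_iff (t := t) hF (fun x => hc.continuousWithinAt) hlow hup
  refine le_antisymm ?_ ((h _).1 le_rfl)
  have hev : ∀ᶠ y in 𝓝[<] (quantile F u), F y ≤ u := by
    filter_upwards [self_mem_nhdsWithin] with y hy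
    exact le_of_not_ge fun hle => (not_le.2 hy) ((h y).2 hle)
  exact le_of_tendsto (hc.continuousWithinAt (s := Set.Iio _)) hev

variable {n : ℕ} (x : Fin n → ℝ)

theorem empDistFun_mono : Monotone (empDistFun x) := fun s t hst => by
  refine mul_le_mul_of_nonneg_left (Finset.sum_le_sum fun i _ => ?_) (by positivity)
  by_cases h : x i ≤ s
  · simp [h, h.trans hst]
  · simp only [h, if_false]; split_ifs <;> simp

theorem continuousWithinAt_empDistFun (t : ℝ) :
    ContinuousWithinAt (empDistFun x) (Set.Ici t) t := by
  refine tendsto_const_nhds.mul (tendsto_finsetSum _ fun i _ => ?_)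
  refine tendsto_const_nhds.congr' ?_
  by_cases h : x i ≤ t
  · filter_upwards [self_mem_nhdsWithin] with s hs
    simp [h, h.trans hs]
  · filter_upwards [mem_nhdsWithin_of_mem_nhds (Iio_mem_nhds (not_le.1 h))] with s hs
    simp [h, not_le.2 (Set.mem_Iio.1 hs)]

theorem empQuantile_le_iff (hn : 1 ≤ n) {u t : ℝ} (hu : u ∈ Set.Ioo (0 : ℝ) 1) :
    empQuantile x u ≤ t ↔ u ≤ empDistFun x t := by
  have hn0 : (n : ℝ) ≠ 0 := by positivity
  have hne : Nonempty (Fin n) := ⟨⟨0, hn⟩⟩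
  refine quantile_le_iff (empDistFun_mono x) (continuousWithinAt_empDistFun x) ?_ ?_
  · obtain ⟨y, hy⟩ := (Set.finite_range x).bddBelow
    refine ⟨y - 1, ?_⟩
    have : ∀ i, ¬ x i ≤ y - 1 := fun i h => by
      have := hy (Set.mem_range_self i); linarith
    simpa [empDistFun, this] using hu.1
  · obtain ⟨y, hy⟩ := (Set.finite_range x).bddAbove
    have : ∀ i, x i ≤ y := fun i => hy (Set.mem_range_self i)
    refine ⟨y, ?_⟩
    simpa [empDistFun, this, hn0] using hu.2.le

/-- To the left of `q` there is a point with no observation strictly between it and `q`. -/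
theorem exists_lt_forall_le (q : ℝ) : ∃ t < q, ∀ i, x i < q → x i ≤ t := by
  have : ∀ᶠ t in 𝓝[<] q, ∀ i, x i < q → x i ≤ t := by
    rw [eventually_all]
    intro i
    by_cases h : x i < q
    · filter_upwards [mem_nhdsWithin_of_mem_nhds (Ioi_mem_nhds h)] with t ht _ using le_of_lt ht
    · simp [h]
  obtain ⟨t, ht, htq⟩ := (this.and self_mem_nhdsWithin).exists
  exact ⟨t, htq, ht⟩

/-- If no observation equals `q`, the empirical distribution function is constant on some `[t, q]`
with `t < q`, so the non-strict equivalence can be applied at `t`. -/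
theorem empQuantile_lt_iff (hn : 1 ≤ n) {u q : ℝ} (hu : u ∈ Set.Ioo (0 : ℝ) 1)
    (hq : ∀ i, x i ≠ q) : empQuantile x u < q ↔ u ≤ empDistFun x q := by
  refine ⟨fun h => (empQuantile_le_iff x hn hu).1 h.le, fun h => ?_⟩
  obtain ⟨t, htq, ht⟩ := exists_lt_forall_le x q
  refine lt_of_le_of_lt ((empQuantile_le_iff x hn hu).2 (h.trans (le_of_eq ?_))) htq
  unfold empDistFun
  congr 1
  refine Finset.sum_congr rfl fun i _ => ?_
  by_cases hi : x i ≤ q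
  · simp [hi, ht i (lt_of_le_of_ne hi (hq i))]
  · simp [hi, htq.trans (not_le.1 hi)]

/-- Just left of the empirical quantile the empirical distribution function is below `u`, at it at
least `u`; without ties the jump there is at most `1 / n`. -/
theorem abs_empDistFun_empQuantile_sub_le (hn : 1 ≤ n) {u : ℝ} (hu : u ∈ Set.Ioo (0 : ℝ) 1)
    (hx : Function.Injective x) :
    |(n : ℝ) * (empDistFun x (empQuantile x u) - u)| ≤ 1 := by
  have hn0 : (0 : ℝ) < n := by positivity
  set q := empQuantile x u with hq
  have h1 : u ≤ empDistFun x q := (empQuantile_le_iff x hn hu).1 le_rfl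
  obtain ⟨t, htq, ht⟩ := exists_lt_forall_le x q
  have h2 : empDistFun x t < u :=
    lt_of_not_ge fun h => htq.not_ge ((empQuantile_le_iff x hn hu).2 h)
  have h3 : (n : ℝ) * empDistFun x q ≤ n * empDistFun x t + 1 := by
    have e : ∀ y, (n : ℝ) * empDistFun x y = ∑ i, if x i ≤ y then (1 : ℝ) else 0 := fun y => by
      rw [empDistFun, mul_inv_cancel_left₀ hn0.ne']
    rw [e, e]
    have hone : ∑ i, (if x i = q then (1 : ℝ) else 0) ≤ 1 := by
      rw [Finset.sum_boole]
      exact_mod_cast Finset.card_le_one.2 fun i hi j hj =>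
        by
          rw [Finset.mem_filter] at hi hj
          exact hx (hi.2.trans hj.2.symm)
    refine le_trans ?_ (add_le_add_right hone _)
    rw [← Finset.sum_add_distrib]
    refine Finset.sum_le_sum fun i _ => ?_
    by_cases hi : x i = q
    · simp only [hi, le_refl, if_true]; split_ifs <;> simp
    · by_cases hi' : x i ≤ q
      · simp [hi', hi, ht i (lt_of_le_of_ne hi' hi)]
      · simp only [hi', hi, if_false]; split_ifs <;> simp
  rw [abs_le]
  constructor <;> nlinarith

variable {x} in
theorem varEst_eq (I : Finpartition (Finset.univ : Finset (Fin n))) (τ : ℝ) :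
    varEst I x τ = (n : ℝ)⁻¹ * ∑ J ∈ I.parts, groupStat J x (empQuantile x τ) := by
  unfold varEst
  simp_rw [sum_sum_ite_eq]
  rfl

theorem sum_parts_card (I : Finpartition (Finset.univ : Finset (Fin n))) :
    ∑ J ∈ I.parts, (J.card : ℝ) = n := by
  have := I.sum_card_parts
  rw [Finset.card_univ, Fintype.card_fin] at this
  exact_mod_cast this

theorem sum_groupStat_nonneg {I : Finpartition (Finset.univ : Finset (Fin n))}
    (hI : ∀ J ∈ I.parts, 2 ≤ J.card) (q : ℝ) : 0 ≤ ∑ J ∈ I.parts, groupStat J x q :=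
  Finset.sum_nonneg fun J hJ => groupStat_nonneg (hI J hJ) x q

theorem varEst_le {I : Finpartition (Finset.univ : Finset (Fin n))}
    (hI : ∀ J ∈ I.parts, 2 ≤ J.card) (hn : 1 ≤ n) (τ : ℝ) : varEst I x τ ≤ 1 / 2 := by
  have hn0 : (0 : ℝ) < n := by positivity
  rw [varEst_eq, inv_mul_le_iff₀ hn0]
  calc _ ≤ ∑ J ∈ I.parts, (J.card : ℝ) / 2 :=
        Finset.sum_le_sum fun J hJ => groupStat_le (hI J hJ) _ _
    _ = _ := by rw [← Finset.sum_div, sum_parts_card]; ring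

/-- For counts `a ≤ b` the difference factors as `(b - a) (m - a - b) / (m - 1)`, and `|m - a - b| ≤
m ≤ 2 (m - 1)` because `m ≥ 2`. -/
theorem abs_groupStat_sub_le {ι : Type*} {J : Finset ι} (hJ : 2 ≤ J.card) (x : ι → ℝ)
    {q r : ℝ} (hqr : q ≤ r) :
    |groupStat J x r - groupStat J x q| ≤ 2 * (groupCount J x r - groupCount J x q) := by
  have h2 : (2 : ℝ) ≤ J.card := by exact_mod_cast hJ
  have hmono : groupCount J x q ≤ groupCount J x r := Finset.sum_le_sum fun i _ => by
    by_cases h : x i ≤ q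
    · simp [h, h.trans hqr]
    · simp only [h, if_false]; split_ifs <;> simp
  have a0 := groupCount_nonneg J x q
  have b0 := groupCount_nonneg J x r
  have a1 := groupCount_le_card J x q
  have b1 := groupCount_le_card J x r
  set a := groupCount J x q
  set b := groupCount J x r
  have e : groupStat J x r - groupStat J x q
      = ((J.card : ℝ) - 1)⁻¹ * ((b - a) * (J.card - a - b)) := by
    unfold groupStat; ring
  have hpos : (0 : ℝ) < J.card - 1 := by linarith
  rw [e, abs_mul, abs_of_pos (inv_pos.2 hpos), inv_mul_le_iff₀ hpos, abs_mul,
    abs_of_nonneg (sub_nonneg.2 hmono)]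
  have : |(J.card : ℝ) - a - b| ≤ 2 * (J.card - 1) := by
    rw [abs_le]; constructor <;> linarith
  nlinarith [mul_le_mul_of_nonneg_left this (sub_nonneg.2 hmono)]

/-- Group counts are monotone in the threshold, so the groupwise bounds add up without cancellation.
This controls the effect of inserting the random empirical quantile. -/
theorem abs_sum_groupStat_sub_le {I : Finpartition (Finset.univ : Finset (Fin n))}
    (hI : ∀ J ∈ I.parts, 2 ≤ J.card) (q r : ℝ) :
    |∑ J ∈ I.parts, groupStat J x r - ∑ J ∈ I.parts, groupStat J x q|
      ≤ 2 * |(n : ℝ) * (empDistFun x r - empDistFun x q)| := by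
  wlog hqr : q ≤ r generalizing q r
  · have := this r q (le_of_not_ge hqr)
    rwa [abs_sub_comm, mul_sub, abs_sub_comm (_ * _), ← mul_sub]
  rcases Nat.eq_zero_or_pos n with rfl | hn
  · have : I.parts = ∅ := by
      rw [Finset.eq_empty_iff_forall_notMem]
      intro J hJ
      have := hI J hJ
      have h0 : J = ∅ := Finset.eq_empty_of_isEmpty J
      simp [h0] at this
    simp [this]
  have hn0 : (n : ℝ) ≠ 0 := by positivity
  have hcount : ∀ y, ∑ J ∈ I.parts, groupCount J x y = n * empDistFun x y := fun y => by
    rw [empDistFun, mul_inv_cancel_left₀ hn0]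
    have h := Finset.sum_biUnion (s := I.parts) (t := id)
      (f := fun i => if x i ≤ y then (1 : ℝ) else 0) I.disjoint
    rw [I.biUnion_parts] at h
    exact h.symm
  rw [← Finset.sum_sub_distrib]
  calc _ ≤ ∑ J ∈ I.parts, 2 * (groupCount J x r - groupCount J x q) :=
        (Finset.abs_sum_le_sum_abs _ _).trans
          (Finset.sum_le_sum fun J hJ => abs_groupStat_sub_le (hI J hJ) x hqr)
    _ = 2 * (n * (empDistFun x r - empDistFun x q)) := by
        rw [← Finset.mul_sum, Finset.sum_sub_distrib, hcount, hcount, ← mul_sub]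
    _ ≤ _ := by gcongr; exact le_abs_self _

end Quantile

/-! ### Measurability, and absence of atoms and ties. -/

section RandomSample

variable {Ω : Type*} [MeasurableSpace Ω] {P : Measure Ω} {n : ℕ} {X : Fin n → Ω → ℝ}

theorem measurable_empDistFun (hX : ∀ i, Measurable (X i)) (t : ℝ) :
    Measurable fun ω => empDistFun (fun i => X i ω) t :=
  (Finset.measurable_sum _ fun i _ => measurable_ind (hX i) t).const_mul _

theorem measurable_empQuantile (hX : ∀ i, Measurable (X i)) (hn : 1 ≤ n) {u : ℝ}
    (hu : u ∈ Set.Ioo (0 : ℝ) 1) : Measurable fun ω => empQuantile (fun i => X i ω) u := by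
  refine measurable_of_Iic fun t => ?_
  have : (fun ω => empQuantile (fun i => X i ω) u) ⁻¹' Set.Iic t
      = {ω | u ≤ empDistFun (fun i => X i ω) t} := by
    ext ω
    exact empQuantile_le_iff _ hn hu
  rw [this]
  exact measurableSet_le measurable_const (measurable_empDistFun hX t)

theorem measurable_varEst (hX : ∀ i, Measurable (X i)) (hn : 1 ≤ n) {u : ℝ}
    (hu : u ∈ Set.Ioo (0 : ℝ) 1) (I : Finpartition (Finset.univ : Finset (Fin n))) :
    Measurable fun ω => varEst I (fun i => X i ω) u := by
  have hq := measurable_empQuantile hX hn hu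
  refine Measurable.const_mul (Finset.measurable_sum _ fun J _ => Measurable.const_mul
    (Finset.measurable_sum _ fun k _ => Finset.measurable_sum _ fun l _ => ?_) _) _
  exact Measurable.ite ((measurableSet_le (hX k) hq).inter (measurableSet_lt hq (hX l)))
    measurable_const measurable_const

theorem avgDistFun_mono : Monotone (avgDistFun P X) := fun _ _ hst =>
  mul_le_mul_of_nonneg_left (Finset.sum_le_sum fun i _ => monotone_cdf _ hst) (by positivity)

theorem avgDistFun_avgQuantile (hn : 1 ≤ n) (hc : Continuous (avgDistFun P X))
    {u : ℝ} (hu : u ∈ Set.Ioo (0 : ℝ) 1) : avgDistFun P X (avgQuantile P X u) = u := by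
  have hn0 : (n : ℝ) ≠ 0 := by positivity
  have hbot : Tendsto (avgDistFun P X) atBot (𝓝 ((n : ℝ)⁻¹ * ∑ _i : Fin n, (0 : ℝ))) :=
    tendsto_const_nhds.mul (tendsto_finsetSum _ fun i _ => tendsto_cdf_atBot _)
  have htop : Tendsto (avgDistFun P X) atTop (𝓝 ((n : ℝ)⁻¹ * ∑ _i : Fin n, (1 : ℝ))) :=
    tendsto_const_nhds.mul (tendsto_finsetSum _ fun i _ => tendsto_cdf_atTop _)
  refine apply_quantile avgDistFun_mono hc
    (hbot.eventually_lt_const (by simpa using hu.1)).exists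
    ((htop.eventually_const_lt (by simpa [hn0] using hu.2)).exists.imp fun _ h => h.le)

variable [IsProbabilityMeasure P]

/-- For `y < q` the mass at `q` is at most the increment of one distribution function over `(y, q]`,
hence at most `n` times that of the average, which tends to 0 as `y ↑ q`. -/
theorem measureReal_eq_zero_of_continuous (hX : ∀ i, Measurable (X i))
    (hc : Continuous (avgDistFun P X)) (i : Fin n) (q : ℝ) : P.real {ω | X i ω = q} = 0 := by
  have hn0 : (n : ℝ) ≠ 0 := by have := i.pos; positivity
  refine le_antisymm ?_ measureReal_nonneg
  have hlim : Tendsto (fun y => (n : ℝ) * (avgDistFun P X q - avgDistFun P X y)) (𝓝[<] q) (𝓝 0) := by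
    have := (hc.continuousWithinAt (s := Set.Iio q) (x := q)).tendsto
    simpa using ((tendsto_const_nhds (x := avgDistFun P X q)).sub this).const_mul (n : ℝ)
  refine ge_of_tendsto hlim ?_
  filter_upwards [self_mem_nhdsWithin] with y hy
  have hy' : y < q := hy
  have h1 : P.real {ω | X i ω = q} + P.real {ω | X i ω ≤ y} ≤ P.real {ω | X i ω ≤ q} := by
    rw [← measureReal_union _ (measurableSet_le (hX i) measurable_const)]
    · refine measureReal_mono ?_
      rintro ω (h | h)
      · exact le_of_eq h
      · exact le_trans h hy'.le
    · rw [Set.disjoint_left]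
      intro ω h h'
      exact hy'.not_ge (h ▸ h')
  rw [← distFun_eq_real (hX i), ← distFun_eq_real (hX i)] at h1
  have h2 : (n : ℝ) * (avgDistFun P X q - avgDistFun P X y)
      = ∑ j, (distFun P (X j) q - distFun P (X j) y) := by
    rw [avgDistFun, avgDistFun, ← mul_sub, mul_inv_cancel_left₀ hn0, Finset.sum_sub_distrib]
  rw [h2]
  have h3 := Finset.single_le_sum (f := fun j => distFun P (X j) q - distFun P (X j) y)
    (fun j _ => sub_nonneg.2 (monotone_cdf _ hy'.le)) (Finset.mem_univ i)
  linarith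

theorem ae_ne_of_continuous (hX : ∀ i, Measurable (X i))
    (hc : Continuous (avgDistFun P X)) (q : ℝ) : ∀ᵐ ω ∂P, ∀ i, X i ω ≠ q := by
  rw [ae_all_iff]
  intro i
  have := measureReal_eq_zero_of_continuous hX hc i q
  rw [measureReal_eq_zero_iff] at this
  rw [ae_iff]
  simpa using this

/-- By independence each pair has a product law, and the diagonal is null by Fubini because the
marginals have no atoms. -/
theorem ae_injective_of_continuous (hX : ∀ i, Measurable (X i)) (hind : iIndepFun X P)
    (hc : Continuous (avgDistFun P X)) : ∀ᵐ ω ∂P, Function.Injective fun i => X i ω := by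
  have h : ∀ i j, i ≠ j → ∀ᵐ ω ∂P, X i ω ≠ X j ω := fun i j hij => by
    have hmap := (indepFun_iff_map_prod_eq_prod_map_map (hX i).aemeasurable
      (hX j).aemeasurable).1 (hind.indepFun hij)
    have hd : MeasurableSet {p : ℝ × ℝ | p.1 = p.2} := measurableSet_eq_fun measurable_fst
      measurable_snd
    rw [ae_iff]
    simp only [not_not, ne_eq]
    have e : {ω | X i ω = X j ω} = (fun ω => (X i ω, X j ω)) ⁻¹' {p : ℝ × ℝ | p.1 = p.2} := rfl
    rw [e, ← Measure.map_apply ((hX i).prodMk (hX j)) hd, hmap]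
    have := Measure.isProbabilityMeasure_map (μ := P) (hX j).aemeasurable
    rw [Measure.measure_prod_null hd]
    refine Eventually.of_forall fun a => ?_
    have h0 := measureReal_eq_zero_of_continuous hX hc j a
    rw [measureReal_eq_zero_iff] at h0
    change (P.map (X j)) (Prod.mk a ⁻¹' _) = 0
    rw [Measure.map_apply (hX j) (hd.preimage measurable_prodMk_left)]
    convert h0 using 2
    ext ω
    simp [eq_comm]
  have h' : ∀ᵐ ω ∂P, ∀ i j, i ≠ j → X i ω ≠ X j ω := by
    simp only [ae_all_iff]
    exact fun i j hij => h i j hij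
  filter_upwards [h'] with ω hω i j hij
  by_contra hne
  exact hω i j hne hij
end RandomSample
end HetQuantile

namespace HetQuantile
-- Ratio consistency of the variance estimator and studentization.
noncomputable section Consistency

/-- From `|s - √W| (s + √W) = |s² - W|` one gets `|s - √W| ≤ δ s`; then `√W ≥ s / 2`, so the
relative error is at most `2 δ`. -/
theorem abs_div_sqrt_sub_div_le {y s W δ : ℝ} (hs : 0 < s) (hδ : δ ≤ 1 / 2)
    (hW : |W / s ^ 2 - 1| < δ) : |y / √W - s⁻¹ * y| ≤ 2 * δ * |s⁻¹ * y| := by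
  have hs2 : 0 < s ^ 2 := by positivity
  have hW' : |W - s ^ 2| < δ * s ^ 2 := by
    rw [← div_lt_iff₀ hs2]
    calc |W - s ^ 2| / s ^ 2 = |(W - s ^ 2) / s ^ 2| := by rw [abs_div, abs_of_pos hs2]
      _ = |W / s ^ 2 - 1| := by congr 1; field_simp
      _ < δ := hW
  have hWpos : 0 < W := by nlinarith [(abs_lt.1 hW').1]
  set r := √W with hr
  have hrpos : 0 < r := Real.sqrt_pos.2 hWpos
  have hrW : r ^ 2 = W := Real.sq_sqrt hWpos.le
  have hsr : |s - r| ≤ δ * s := by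
    have h1 : |s - r| * (s + r) = |W - s ^ 2| := by
      rw [← hrW, show r ^ 2 - s ^ 2 = -((s - r) * (s + r)) by ring, abs_neg, abs_mul,
        abs_of_pos (add_pos hs hrpos)]
    have h2 : |s - r| * s ≤ |s - r| * (s + r) := by gcongr; linarith
    have h3 : |s - r| * s ≤ δ * s * s := by nlinarith
    exact le_of_mul_le_mul_right h3 hs
  have hr2 : s / 2 ≤ r := by
    have h := (abs_le.1 hsr).2
    have : δ * s ≤ 1 / 2 * s := by gcongr
    linarith
  have e : y / r - s⁻¹ * y = (s - r) / r * (s⁻¹ * y) := by field_simp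
  rw [e, abs_mul]
  refine mul_le_mul_of_nonneg_right ?_ (abs_nonneg _)
  rw [abs_div, abs_of_pos hrpos, div_le_iff₀ hrpos]
  have hδ0 : 0 < δ := (abs_nonneg _).trans_lt hW
  nlinarith

variable {Ω : Type*} [MeasurableSpace Ω] {P : Measure Ω} {n : ℕ} {X : Fin n → Ω → ℝ}

theorem mul_avgVar (hn : 1 ≤ n) (τ : ℝ) : (n : ℝ) * avgVar P X τ
    = ∑ i, distFun P (X i) (avgQuantile P X τ) * (1 - distFun P (X i) (avgQuantile P X τ)) := by
  have hn0 : (n : ℝ) ≠ 0 := by positivity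
  rw [avgVar, mul_inv_cancel_left₀ hn0]

theorem sum_centeredInd (hn : 1 ≤ n) (hc : Continuous (avgDistFun P X)) {τ : ℝ}
    (hτ : τ ∈ Set.Ioo (0 : ℝ) 1) (ω : Ω) :
    ∑ i, centeredInd P (X i) (avgQuantile P X τ) ω
      = n * (empDistFun (fun i => X i ω) (avgQuantile P X τ) - τ) := by
  have hn0 : (n : ℝ) ≠ 0 := by positivity
  have h := avgDistFun_avgQuantile hn hc hτ
  rw [avgDistFun, inv_mul_eq_iff_eq_mul₀ hn0] at h
  rw [mul_sub, ← h, empDistFun, mul_inv_cancel_left₀ hn0, ← Finset.sum_sub_distrib]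
  rfl

variable [IsProbabilityMeasure P]

theorem measureReal_ge_le_variance_div_sq {Y : Ω → ℝ} (hY : MemLp Y 2 P) {c : ℝ} (hc : 0 < c) :
    P.real {ω | c ≤ |Y ω - ∫ ω, Y ω ∂P|} ≤ Var[Y; P] / c ^ 2 :=
  ENNReal.toReal_le_of_le_ofReal (div_nonneg (variance_nonneg _ _) (sq_nonneg _))
    (meas_ge_le_variance_div_sq hY hc)

theorem abs_measureReal_sub_le {A B C : Set Ω} (h : ∀ᵐ ω ∂P, ω ∉ C → (ω ∈ A ↔ ω ∈ B)) :
    |P.real A - P.real B| ≤ P.real C := by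
  have key : ∀ {A B : Set Ω}, (∀ᵐ ω ∂P, ω ∉ C → (ω ∈ A ↔ ω ∈ B)) →
      P.real A ≤ P.real B + P.real C := fun {A B} h => by
    have hle : P A ≤ P (B ∪ C) := measure_mono_ae (by
      filter_upwards [h] with ω hω hA
      by_cases hC : ω ∈ C
      · exact Or.inr hC
      · exact Or.inl ((hω hC).1 hA))
    exact (ENNReal.toReal_mono (measure_ne_top _ _) hle).trans (measureReal_union_le _ _)
  have h1 := key h
  have h2 := key (h.mono fun ω hω hC => (hω hC).symm)
  rw [abs_le]
  constructor <;> linarith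

theorem measureReal_sum_centeredInd_ge_le (hX : ∀ i, Measurable (X i)) (hind : iIndepFun X P)
    (q : ℝ) {c : ℝ} (hc : 0 < c) :
    P.real {ω | c ≤ |∑ i, centeredInd P (X i) q ω|}
      ≤ (∑ i, distFun P (X i) q * (1 - distFun P (X i) q)) / c ^ 2 := by
  obtain ⟨hm1, hm2, -⟩ := integral_sum_pow_of_indep
    (fun i => measurable_centeredInd (P := P) (hX i) q)
    (fun i ω => abs_centeredInd_le (X i) q ω) (fun i => integral_centeredInd (hX i) q)
    (iIndepFun_centeredInd hind q) Finset.univ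
  have hm : Measurable fun ω => ∑ i, centeredInd P (X i) q ω :=
    Finset.measurable_sum _ fun i _ => measurable_centeredInd (hX i) q
  have hL : MemLp (fun ω => ∑ i, centeredInd P (X i) q ω) 2 P :=
    MemLp.of_bound hm.aestronglyMeasurable n (Eventually.of_forall fun ω =>
      (Finset.abs_sum_le_sum_abs _ _).trans
        ((Finset.sum_le_sum fun i _ => abs_centeredInd_le _ _ _).trans (by simp)))
  have h := measureReal_ge_le_variance_div_sq hL hc
  rw [variance_of_integral_eq_zero hm.aemeasurable hm1, hm2, hm1] at h
  simpa only [sub_zero, integral_centeredInd_sq (hX _)] using h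

/-- The variance estimator is close to the variance with high probability. -/
theorem measureReal_varEst_ge_le (hX : ∀ i, Measurable (X i)) (hind : iIndepFun X P)
    (hc : Continuous (avgDistFun P X)) (hn : 1 ≤ n)
    (I : Finpartition (Finset.univ : Finset (Fin n))) (hcard : ∀ J ∈ I.parts, 2 ≤ J.card)
    (hident : ∀ J ∈ I.parts, ∀ i ∈ J, ∀ i' ∈ J, distFun P (X i) = distFun P (X i'))
    {τ : ℝ} (hτ : τ ∈ Set.Ioo (0 : ℝ) 1) {δ : ℝ} (hδ : 0 < δ)
    (hbig : 6 < δ * (n * avgVar P X τ)) :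
    P.real {ω | δ ≤ |n * varEst I (fun i => X i ω) τ / (n * avgVar P X τ) - 1|}
      ≤ 144 / (δ ^ 2 * (n * avgVar P X τ)) := by
  have hn0 : (n : ℝ) ≠ 0 := by positivity
  set q := avgQuantile P X τ with hq
  set v := (n : ℝ) * avgVar P X τ with hv
  have hv' := mul_avgVar (P := P) (X := X) hn τ
  rw [← hv, ← hq] at hv'
  have hvpos : 0 < v := by
    by_contra! h
    nlinarith
  obtain ⟨hW1, hW2⟩ := sum_groupStat_moments hX hind I hcard hident q
  rw [← hv'] at hW1 hW2
  set W : Ω → ℝ := fun ω => ∑ J ∈ I.parts, groupStat J (fun i => X i ω) q with hWdef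
  have hWm : Measurable W := measurable_sum_groupStat hX _ q
  have hWL : MemLp W 2 P := MemLp.of_bound hWm.aestronglyMeasurable (n / 2)
    (Eventually.of_forall fun ω => by
      rw [Real.norm_eq_abs, abs_of_nonneg (sum_groupStat_nonneg _ hcard q)]
      calc W ω ≤ ∑ J ∈ I.parts, (J.card : ℝ) / 2 :=
            Finset.sum_le_sum fun J hJ => groupStat_le (hcard J hJ) _ _
        _ = n / 2 := by rw [← Finset.sum_div, sum_parts_card])
  -- Off both bad events the error is below `2 + 2 (δ v / 6) + δ v / 3`, which is less than `δ v`
  -- since `δ v > 6`. The two Chebyshev bounds are `108 / (δ² v)` and `36 / (δ² v)`.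
  have hA := measureReal_ge_le_variance_div_sq hWL (c := δ * v / 3) (by positivity)
  rw [hW1] at hA
  have hB := measureReal_sum_centeredInd_ge_le hX hind q (c := δ * v / 6) (by positivity)
  rw [← hv'] at hB
  set A := {ω | δ * v / 3 ≤ |W ω - v|}
  set B := {ω | δ * v / 6 ≤ |∑ i, centeredInd P (X i) q ω|}
  have hsub : P {ω | δ ≤ |n * varEst I (fun i => X i ω) τ / v - 1|} ≤ P (A ∪ B) := by
    refine measure_mono_ae ?_
    filter_upwards [ae_injective_of_continuous hX hind hc] with ω hω hmem
    have hmem' : δ ≤ |n * varEst I (fun i => X i ω) τ / v - 1| := hmem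
    set x := fun i => X i ω with hx
    have h1 := abs_sum_groupStat_sub_le x hcard q (empQuantile x τ)
    have h2 := abs_empDistFun_empQuantile_sub_le x hn hτ hω
    have h3 := sum_centeredInd hn hc hτ ω
    rw [← hq, ← hx] at h3
    rw [varEst_eq, mul_inv_cancel_left₀ hn0] at hmem'
    set W' := ∑ J ∈ I.parts, groupStat J x (empQuantile x τ)
    have h4 : δ * v ≤ |W' - v| := by
      rw [← le_div_iff₀ hvpos]
      refine hmem'.trans (le_of_eq ?_)
      rw [← abs_of_pos hvpos, ← abs_div, abs_of_pos hvpos]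
      congr 1; field_simp
    have h5 : |W' - v| ≤ |W' - W ω| + |W ω - v| := abs_sub_le _ _ _
    have h6 : |(n : ℝ) * (empDistFun x (empQuantile x τ) - empDistFun x q)|
        ≤ 1 + |∑ i, centeredInd P (X i) q ω| := by
      rw [h3]
      calc _ = |(n : ℝ) * (empDistFun x (empQuantile x τ) - τ) - n * (empDistFun x q - τ)| := by
            congr 1; ring
        _ ≤ _ + _ := abs_sub _ _
        _ ≤ _ := by gcongr
    change ω ∈ A ∪ B
    by_contra hcon
    rw [Set.mem_union, not_or] at hcon
    have h7 : |W ω - v| < δ * v / 3 := not_le.1 hcon.1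
    have h8 : |∑ i, centeredInd P (X i) q ω| < δ * v / 6 := not_le.1 hcon.2
    change |W' - W ω| ≤ _ at h1
    linarith
  calc _ ≤ P.real (A ∪ B) := ENNReal.toReal_mono (measure_ne_top _ _) hsub
    _ ≤ P.real A + P.real B := measureReal_union_le _ _
    _ ≤ 12 * v / (δ * v / 3) ^ 2 + v / (δ * v / 6) ^ 2 := by
        refine add_le_add (hA.trans ?_) hB
        gcongr
    _ = _ := by field_simp; norm_num

/-- The normalization by the estimated variance may be replaced by the true variance. -/
theorem measureReal_studentized_sub_ge_le (hX : ∀ i, Measurable (X i)) (hind : iIndepFun X P)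
    (hc : Continuous (avgDistFun P X)) (hn : 1 ≤ n)
    (I : Finpartition (Finset.univ : Finset (Fin n))) (hcard : ∀ J ∈ I.parts, 2 ≤ J.card)
    (hident : ∀ J ∈ I.parts, ∀ i ∈ J, ∀ i' ∈ J, distFun P (X i) = distFun P (X i'))
    {τ : ℝ} (hτ : τ ∈ Set.Ioo (0 : ℝ) 1) {ε s : ℝ} (hε : 0 < ε) (hs : 6 < s)
    (hsv : s ^ 2 = n * avgVar P X τ) :
    P.real {ω | ε ≤ |√((n : ℝ) / varEst I (fun i => X i ω) τ) *
          (empDistFun (fun i => X i ω) (avgQuantile P X τ) - τ) -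
        s⁻¹ * ∑ i, centeredInd P (X i) (avgQuantile P X τ) ω|}
      ≤ (144 + 4 / ε ^ 2) * s⁻¹ := by
  have hn0 : (n : ℝ) ≠ 0 := by positivity
  have hs0 : 0 < s := by linarith
  -- The choice `δ = s ^ (-1/2)` balances two demands: the variance ratio is within `δ` of 1 up to
  -- probability `144 / s`, while `|S| / s` may grow to `ε √s / 2`, exceeded with probability at
  -- most `4 / (ε² s)`.
  set r := √s with hr
  have hr2 : r ^ 2 = s := Real.sq_sqrt hs0.le
  have hrle : 2 ≤ r := Real.le_sqrt_of_sq_le (by linarith)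
  have hr0 : 0 < r := by linarith
  have hA := measureReal_varEst_ge_le hX hind hc hn I hcard hident hτ (δ := r⁻¹) (by positivity) (by
    rw [← hsv, inv_mul_eq_div, lt_div_iff₀ hr0, ← hr2]
    nlinarith [mul_pos hr0 hr0])
  have hB := measureReal_sum_centeredInd_ge_le hX hind (avgQuantile P X τ)
    (c := ε * r / 2 * s) (by positivity)
  rw [← mul_avgVar hn] at hB
  rw [← hsv] at hA hB
  set A := {ω | r⁻¹ ≤ |n * varEst I (fun i => X i ω) τ / s ^ 2 - 1|}
  set B := {ω | ε * r / 2 * s ≤ |∑ i, centeredInd P (X i) (avgQuantile P X τ) ω|}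
  calc _ ≤ P.real (A ∪ B) := by
        refine measureReal_mono ?_
        intro ω hω
        have hω' : ε ≤ _ := hω
        by_contra hcon
        rw [Set.mem_union, not_or] at hcon
        have h7 : |n * varEst I (fun i => X i ω) τ / s ^ 2 - 1| < r⁻¹ := not_le.1 hcon.1
        have h8 : |∑ i, centeredInd P (X i) (avgQuantile P X τ) ω| < ε * r / 2 * s :=
          not_le.1 hcon.2
        have hδ : r⁻¹ ≤ 1 / 2 := by
          rw [one_div]; exact inv_anti₀ (by norm_num) hrle
        have h9 := abs_div_sqrt_sub_div_le
          (y := ∑ i, centeredInd P (X i) (avgQuantile P X τ) ω) hs0 hδ h7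
        have e : √((n : ℝ) / varEst I (fun i => X i ω) τ) *
              (empDistFun (fun i => X i ω) (avgQuantile P X τ) - τ)
            = (∑ i, centeredInd P (X i) (avgQuantile P X τ) ω) /
              √(n * varEst I (fun i => X i ω) τ) := by
          rw [sum_centeredInd hn hc hτ, Real.sqrt_div (by positivity), Real.sqrt_mul (by positivity)]
          have hsq : √(n : ℝ) * √(n : ℝ) = n := Real.mul_self_sqrt (by positivity)
          have hsq0 : √(n : ℝ) ≠ 0 := by positivity
          -- When the estimator vanishes, both sides are 0 by the convention for division by zero.
          rcases eq_or_ne (√(varEst I (fun i => X i ω) τ)) 0 with h0 | h0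
          · simp [h0]
          · rw [div_mul_eq_mul_div, div_eq_div_iff h0 (mul_ne_zero hsq0 h0)]
            linear_combination (empDistFun (fun i => X i ω) (avgQuantile P X τ) - τ) *
              √(varEst I (fun i => X i ω) τ) * hsq
        rw [e] at hω'
        have h10 := hω'.trans h9
        rw [abs_mul, abs_inv, abs_of_pos hs0] at h10
        have h11 : 2 * r⁻¹ * (s⁻¹ * |∑ i, centeredInd P (X i) (avgQuantile P X τ) ω|)
            < 2 * r⁻¹ * (s⁻¹ * (ε * r / 2 * s)) := by gcongr
        have h12 : 2 * r⁻¹ * (s⁻¹ * (ε * r / 2 * s)) = ε := by field_simp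
        linarith
    _ ≤ P.real A + P.real B := measureReal_union_le _ _
    _ ≤ 144 / ((r⁻¹) ^ 2 * s ^ 2) + s ^ 2 / (ε * r / 2 * s) ^ 2 := add_le_add hA hB
    _ = _ := by
        rw [inv_pow, hr2, mul_pow, div_pow, mul_pow, hr2]
        field_simp
        norm_num
end Consistency
end HetQuantile

namespace HetQuantile
-- Normal quantiles, convergence of probabilities, and inversion to an interval.
noncomputable section Gaussian

theorem continuous_cdf_of_nullSingleton {μ : Measure ℝ} [IsProbabilityMeasure μ]
    (h : ∀ x, μ {x} = 0) : Continuous fun t => cdf μ t := by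
  rw [continuous_iff_continuousAt]
  intro a
  rw [(monotone_cdf μ).continuousAt_iff_leftLim_eq_rightLim, StieltjesFunction.rightLim_eq]
  refine le_antisymm ((monotone_cdf μ).leftLim_le le_rfl) ?_
  have h1 := h a
  rw [← measure_cdf μ, StieltjesFunction.measure_singleton, ENNReal.ofReal_eq_zero] at h1
  linarith

/-- The two-sided standard normal quantile interval has the nominal probability. -/
theorem gaussianReal_Ico_quantile {α : ℝ} (hα : α ∈ Set.Ioo (0 : ℝ) 1) :
    0 ≤ quantile (fun t => cdf (gaussianReal 0 1) t) (1 - α / 2) ∧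
    (gaussianReal 0 1).real (Set.Ico (-quantile (fun t => cdf (gaussianReal 0 1) t) (1 - α / 2))
      (quantile (fun t => cdf (gaussianReal 0 1) t) (1 - α / 2))) = 1 - α := by
  set μ := gaussianReal 0 1 with hμ
  have hns : NullSingletonClass μ := nullSingletonClass_gaussianReal one_ne_zero
  set z := quantile (fun t => cdf μ t) (1 - α / 2) with hz
  have hΦ : cdf μ z = 1 - α / 2 := apply_quantile (F := fun t => cdf μ t) (monotone_cdf μ)
    (continuous_cdf_of_nullSingleton fun x => measure_singleton x)
    ((tendsto_cdf_atBot μ).eventually_lt_const (by linarith [hα.2])).exists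
    (((tendsto_cdf_atTop μ).eventually_const_lt (by linarith [hα.1])).exists.imp fun _ h => h.le)
  rw [cdf_eq_real] at hΦ
  have hIio : μ.real (Set.Iio z) = 1 - α / 2 := by
    rw [← hΦ]; exact measureReal_congr Iio_ae_eq_Iic
  have hsymm : μ.real (Set.Iio (-z)) = α / 2 := by
    have hneg : μ.map (fun x => -x) = μ := by
      rw [hμ, gaussianReal_map_neg, neg_zero]
    have h1 : μ.real (Set.Iio (-z)) = μ.real (Set.Iic z)ᶜ := by
      conv_lhs => rw [← hneg]
      rw [map_measureReal_apply measurable_neg measurableSet_Iio]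
      congr 1
      ext x
      simp
    rw [h1, probReal_compl_eq_one_sub measurableSet_Iic, hΦ]
    ring
  have hz0 : 0 ≤ z := by
    by_contra! hneg
    have := measureReal_mono (μ := μ) (Set.Iio_subset_Iio (show z ≤ -z by linarith))
    rw [hIio, hsymm] at this
    linarith [hα.2]
  refine ⟨hz0, ?_⟩
  have hu : Set.Iio (-z) ∪ Set.Ico (-z) z = Set.Iio z :=
    Set.Iio_union_Ico_eq_Iio (by linarith)
  have hd : Disjoint (Set.Iio (-z)) (Set.Ico (-z) z) := by
    rw [Set.disjoint_left]
    exact fun x hx hx' => (not_le.2 hx) hx'.1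
  have := measureReal_union (μ := μ) hd measurableSet_Ico
  rw [hu, hIio, hsymm] at this
  linarith

end Gaussian

section Portmanteau

theorem tendsto_measureReal_of_tendstoInDistribution {Ω : ℕ → Type*} [∀ n, MeasurableSpace (Ω n)]
    {P : (n : ℕ) → Measure (Ω n)} [∀ n, IsProbabilityMeasure (P n)] {T : (n : ℕ) → Ω n → ℝ}
    (hT : ∀ n, Measurable (T n)) {μ : Measure ℝ} [IsProbabilityMeasure μ]
    (h : TendstoInDistribution T atTop (id : ℝ → ℝ) P μ) {E : Set ℝ} (hE : MeasurableSet E)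
    (hnull : μ (frontier E) = 0) :
    Tendsto (fun n => (P n).real {ω | T n ω ∈ E}) atTop (𝓝 (μ.real E)) := by
  have h1 := ProbabilityMeasure.tendsto_measure_of_null_frontier_of_tendsto' h.tendsto
    (E := E) (by simpa using hnull)
  simp only [ProbabilityMeasure.coe_mk, Measure.map_id] at h1
  refine ((ENNReal.tendsto_toReal (measure_ne_top μ E)).comp h1).congr fun n => ?_
  exact map_measureReal_apply (hT n) hE

end Portmanteau

section Interval

/-- The interval for the quantile covers `q` exactly if the studentized empirical distribution
function at `q` lies in a normal quantile interval. -/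
theorem quantile_interval_iff {n : ℕ} (hn : 1 ≤ n) (x : Fin n → ℝ) {τ V z q : ℝ} (hV : 0 < V)
    (hq : ∀ i, x i ≠ q) (h1 : τ - √(V / n) * z ∈ Set.Ioo (0 : ℝ) 1)
    (h2 : τ + √(V / n) * z ∈ Set.Ioo (0 : ℝ) 1) :
    (empQuantile x (τ - √(V / n) * z) < q ∧ q < empQuantile x (τ + √(V / n) * z)) ↔
      √((n : ℝ) / V) * (empDistFun x q - τ) ∈ Set.Ico (-z) z := by
  have hn0 : (0 : ℝ) < n := by positivity
  -- The left inequality becomes `τ - c ≤ F̂(q)` and the right one `F̂(q) < τ + c`, hence a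
  -- half-open interval.
  rw [empQuantile_lt_iff x hn h1 hq, ← not_le (a := empQuantile x _),
    empQuantile_le_iff x hn h2, not_le, Set.mem_Ico]
  have hc : 0 < √(V / n) := Real.sqrt_pos.2 (div_pos hV hn0)
  have e : √((n : ℝ) / V) = (√(V / n))⁻¹ := by rw [← Real.sqrt_inv, inv_div]
  rw [e, inv_mul_lt_iff₀ hc, le_inv_mul_iff₀ hc]
  constructor <;> rintro ⟨a, b⟩ <;> constructor <;> linarith

end Interval
end HetQuantile

theorem theorem1
    {Ω : ℕ → Type*} [∀ n, MeasurableSpace (Ω n)]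
    (P : (n : ℕ) → Measure (Ω n)) [∀ n, IsProbabilityMeasure (P n)]
    (X : (n : ℕ) → Fin n → Ω n → ℝ)
    (hmeas : ∀ n i, Measurable (X n i))
    (hindep : ∀ n, iIndepFun (X n) (P n))
    (hcont : ∀ n, 1 ≤ n → Continuous (avgDistFun (P n) (X n)))
    (I : (n : ℕ) → Finpartition (Finset.univ : Finset (Fin n)))
    (hcard : ∀ n, 2 ≤ n → ∀ J ∈ (I n).parts, 2 ≤ J.card)
    (hident : ∀ n, 2 ≤ n → ∀ J ∈ (I n).parts, ∀ i ∈ J, ∀ i' ∈ J,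
      distFun (P n) (X n i) = distFun (P n) (X n i'))
    (τ : ℝ) (hτ : τ ∈ Set.Ioo (0 : ℝ) 1)
    (hV : Tendsto (fun n : ℕ => (n : ℝ) * avgVar (P n) (X n) τ) atTop atTop) :
    TendstoInDistribution
      (fun (n : ℕ) (ω : Ω n) =>
        Real.sqrt ((n : ℝ) / varEst (I n) (fun i => X n i ω) τ) *
          (empDistFun (fun i => X n i ω) (avgQuantile (P n) (X n) τ) - τ))
      atTop (id : ℝ → ℝ) P (gaussianReal 0 1) ∧
    ∀ α ∈ Set.Ioo (0 : ℝ) 1,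
      Tendsto
        (fun n : ℕ => (P n).real {ω |
          empQuantile (fun i => X n i ω) (τ - halfWidth (I n) (fun i => X n i ω) τ α)
              < avgQuantile (P n) (X n) τ ∧
            avgQuantile (P n) (X n) τ
              < empQuantile (fun i => X n i ω) (τ + halfWidth (I n) (fun i => X n i ω) τ α)})
        atTop (𝓝 (1 - α)) := by
  have hvar : ∀ n, 1 ≤ n → ∑ i, ∫ ω, centeredInd (P n) (X n i) (avgQuantile (P n) (X n) τ) ω ^ 2
      ∂(P n) = n * avgVar (P n) (X n) τ := fun n hn => by
    simp only [integral_centeredInd_sq (hmeas n _), mul_avgVar hn]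
  set s : ℕ → ℝ := fun n => √(∑ i, ∫ ω, centeredInd (P n) (X n i)
    (avgQuantile (P n) (X n) τ) ω ^ 2 ∂(P n)) with hs
  set Z : (n : ℕ) → Ω n → ℝ := fun n ω =>
    (s n)⁻¹ * ∑ i, centeredInd (P n) (X n i) (avgQuantile (P n) (X n) τ) ω with hZ
  set T : (n : ℕ) → Ω n → ℝ := fun n ω =>
    √((n : ℝ) / varEst (I n) (fun i => X n i ω) τ) *
      (empDistFun (fun i => X n i ω) (avgQuantile (P n) (X n) τ) - τ) with hT
  have hsum : Tendsto (fun n => ∑ i, ∫ ω, centeredInd (P n) (X n i)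
      (avgQuantile (P n) (X n) τ) ω ^ 2 ∂(P n)) atTop atTop := by
    refine hV.congr' ?_
    filter_upwards [eventually_ge_atTop 1] with n hn using (hvar n hn).symm
  have hsT : Tendsto s atTop atTop := Real.tendsto_sqrt_atTop.comp hsum
  have hTm : ∀ n, Measurable (T n) := fun n => by
    rcases Nat.eq_zero_or_pos n with rfl | hn
    · simp [hT]
    · exact ((measurable_varEst (hmeas n) hn hτ (I n)).const_div _).sqrt.mul
        ((measurable_empDistFun (hmeas n) _).sub_const _)
  have hZm : ∀ n, Measurable (Z n) := fun n => (Finset.measurable_sum _ fun i _ =>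
    measurable_centeredInd (hmeas n i) _).const_mul _
  have hclose : ∀ ε > 0, Tendsto (fun n => (P n).real {ω | ε ≤ |T n ω - Z n ω|}) atTop (𝓝 0) := by
    intro ε hε
    have hlim : Tendsto (fun n => (144 + 4 / ε ^ 2) * (s n)⁻¹) atTop (𝓝 0) := by
      simpa using (tendsto_inv_atTop_zero.comp hsT).const_mul (144 + 4 / ε ^ 2)
    refine squeeze_zero' (Eventually.of_forall fun n => measureReal_nonneg) ?_ hlim
    filter_upwards [eventually_ge_atTop 2, hsT.eventually_gt_atTop 6] with n hn hsn
    refine measureReal_studentized_sub_ge_le (hmeas n) (hindep n) (hcont n (by omega)) (by omega)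
      (I n) (hcard n hn) (hident n hn) hτ hε hsn ?_
    rw [← hvar n (by omega)]
    exact Real.sq_sqrt (Finset.sum_nonneg fun i _ => integral_nonneg fun ω => sq_nonneg _)
  have hcf : ∀ t, Tendsto (fun n => charFun ((P n).map (Z n)) t) atTop
      (𝓝 (Complex.exp (-t ^ 2 / 2))) := fun t =>
    tendsto_charFun_of_bounded_array
      (Y := fun n i => centeredInd (P n) (X n i) (avgQuantile (P n) (X n) τ))
      (fun n i => measurable_centeredInd (hmeas n i) _)
      (fun n i ω => abs_centeredInd_le _ _ ω) (fun n i => integral_centeredInd (hmeas n i) _)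
      (fun n => iIndepFun_centeredInd (hindep n) _) hsum t
  have hdist : TendstoInDistribution T atTop (id : ℝ → ℝ) P (gaussianReal 0 1) := by
    refine ⟨fun n => (hTm n).aemeasurable, aemeasurable_id, ?_⟩
    refine ProbabilityMeasure.tendsto_iff_tendsto_charFun.2 fun t => ?_
    have hlim : charFun ((gaussianReal 0 1).map (id : ℝ → ℝ)) t = Complex.exp (-t ^ 2 / 2) := by
      rw [Measure.map_id, charFun_gaussianReal]
      congr 1
      simp
      ring
    simp only [ProbabilityMeasure.coe_mk]
    rw [hlim]
    exact tendsto_charFun_of_close hZm (fun n => (hTm n).aemeasurable) (hcf t) hclose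
  refine ⟨hdist, fun α hα => ?_⟩
  obtain ⟨hz0, hz⟩ := gaussianReal_Ico_quantile hα
  unfold halfWidth
  set z := quantile (fun t => cdf (gaussianReal 0 1) t) (1 - α / 2) with hzdef
  have hB : Tendsto (fun n => (P n).real {ω | T n ω ∈ Set.Ico (-z) z}) atTop (𝓝 (1 - α)) := by
    have hns : NullSingletonClass (gaussianReal 0 1) := nullSingletonClass_gaussianReal one_ne_zero
    rw [← hz]
    refine tendsto_measureReal_of_tendstoInDistribution hTm hdist measurableSet_Ico ?_
    refine measure_mono_null ?_ ((Set.toFinite {-z, z}).measure_zero _)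
    -- Only `0 ≤ z` is available; for `z = 0` the interval, and so its frontier, is empty.
    rcases eq_or_lt_of_le hz0 with h | h
    · simp [← h]
    · rw [frontier_Ico (by linarith)]
  have hC : Tendsto (fun n => (P n).real {ω | varEst (I n) (fun i => X n i ω) τ ≤ 0})
      atTop (𝓝 0) := by
    have hlim : Tendsto (fun n : ℕ => 144 / ((1 : ℝ) ^ 2 * (n * avgVar (P n) (X n) τ)))
        atTop (𝓝 0) := by
      simpa using hV.const_div_atTop 144
    refine squeeze_zero' (Eventually.of_forall fun n => measureReal_nonneg) ?_ hlim
    filter_upwards [eventually_ge_atTop 2, hV.eventually_gt_atTop 6] with n hn hVn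
    refine le_trans (measureReal_mono fun ω hω => ?_) (measureReal_varEst_ge_le (hmeas n)
      (hindep n) (hcont n (by omega)) (by omega) (I n) (hcard n hn) (hident n hn) hτ one_pos
      (by linarith))
    -- A nonpositive estimate puts the variance ratio at distance at least 1 from 1, so consistency
    -- with `δ = 1` applies.
    have h0 : n * varEst (I n) (fun i => X n i ω) τ / (n * avgVar (P n) (X n) τ) ≤ 0 :=
      div_nonpos_of_nonpos_of_nonneg (mul_nonpos_of_nonneg_of_nonpos (by positivity) hω)
        (by linarith)
    rw [Set.mem_ofPred_eq, abs_sub_comm]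
    exact le_trans (by linarith) (le_abs_self _)
  refine tendsto_of_tendsto_of_dist hB ?_
  refine squeeze_zero' (Eventually.of_forall fun n => dist_nonneg) ?_ hC
  -- Since `V̂ ≤ 1 / 2`, the half-width is at most `z / √n` for every sample. Eventually both levels
  -- `τ ± c` lie in `(0, 1)`, where the quantile equivalences hold.
  have hwidth : Tendsto (fun n : ℕ => √((n : ℝ)⁻¹) * z) atTop (𝓝 0) := by
    have := (Real.continuous_sqrt.tendsto 0).comp
      (tendsto_inv_atTop_zero.comp (tendsto_natCast_atTop_atTop (R := ℝ)))
    simpa using this.mul_const z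
  filter_upwards [eventually_ge_atTop 2, hwidth.eventually_lt_const (lt_min hτ.1 (sub_pos.2 hτ.2))]
    with n hn hw
  rw [dist_comm, Real.dist_eq]
  refine abs_measureReal_sub_le ?_
  filter_upwards [ae_ne_of_continuous (hmeas n) (hcont n (by omega))
    (avgQuantile (P n) (X n) τ)] with ω hω hpos
  have hVpos : 0 < varEst (I n) (fun i => X n i ω) τ := not_le.1 hpos
  have hle : √(varEst (I n) (fun i => X n i ω) τ / n) * z ≤ √((n : ℝ)⁻¹) * z := by
    refine mul_le_mul_of_nonneg_right (Real.sqrt_le_sqrt ?_) hz0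
    rw [div_eq_mul_inv]
    refine mul_le_of_le_one_left (by positivity) ?_
    linarith [varEst_le (fun i => X n i ω) (hcard n hn) (by omega) τ]
  have hnn : 0 ≤ √(varEst (I n) (fun i => X n i ω) τ / n) * z :=
    mul_nonneg (Real.sqrt_nonneg _) hz0
  obtain ⟨hw1, hw2⟩ := lt_min_iff.1 hw
  exact quantile_interval_iff (by omega) _ hVpos hω
    ⟨by linarith, by linarith [hτ.2]⟩ ⟨by linarith [hτ.1], by linarith⟩
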